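/- Let $\mathbb{S}\mathsf{MC}$ be the 2-category whose objects are symmetric monoidal categories, whose 1-morphisms are strong symmetric monoidal functors (functors $F$ with natural coherence isomorphisms $I\cong F(I)$ and $F(c)\otimes F(c')\cong F(c\otimes c')$ compatible with the associators, unitors and braidings), and whose 2-morphisms are monoidal natural transformations. Let $J$ be a (small) set and let $(\mathcal{C}_j)_{j\in J}$ be a family of symmetric monoidal categories, with monoidal units $I_j$. (1) Let $\prod_{j}\mathcal{C}_j$ be the product category with the pointwise symmetric monoidal structure, and let $\pi_j$ be the projections, which are strict monoidal. This is a strict product in $\mathbb{S}\mathsf{MC}$: for every symmetric monoidal category $\mathcal{X}$, composition with the $\pi_j$ is an isomorphism of categories $$\mathbb{S}\mathsf{MC}\Big(\mathcal{X},\prod_{j\in J}\mathcal{C}_j\Big)\;\cong\;\prod_{j\in J}\mathbb{S}\mathsf{MC}(\mathcal{X},\mathcal{C}_j).$$ (2) Let $\bigsqcup_j\mathcal{C}_j$ be the following symmetric monoidal category. Its objects are the families $c=(c_j)_{j\in J}$ of objects $c_j\in\mathcal{C}_j$ with $c_j=I_j$ for all but finitely many $j$; its morphisms $c\to d$ are the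 families of morphisms $f_j\colon c_j\to d_j$ such that, for all but finitely many $j$, $c_j=d_j=I_j$ and $f_j=\mathrm{id}_{I_j}$. The unit is $(I_j)_j$, and the monoidal product and coherence isomorphisms are given pointwise, except that $I_j\otimes I_j$ is replaced by $I_j$ (along the unitor). Let $\mathrm{inc}_j\colon\mathcal{C}_j\to\bigsqcup_{j}\mathcal{C}_j$ be the strong symmetric monoidal functor that sends $c$ to the family with $c$ in position $j$ and the unit in every other position. This is a 2-categorical coproduct in $\mathbb{S}\mathsf{MC}$: for every symmetric monoidal category $\mathcal{X}$, composition with the $\mathrm{inc}_j$ is an equivalence of categories $$\mathbb{S}\mathsf{MC}\Big(\bigsqcup_{j\in J}\mathcal{C}_j,\mathcal{X}\Big)\;\simeq\;\prod_{j\in J}\mathbb{S}\mathsf{MC}(\mathcal{C}_j,\mathcal{X}).$$ In particular $\mathbb{S}\mathsf{MC}$ has all small products and coproducts, and products are strict. -/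

import Mathlib

open CategoryTheory MonoidalCategory

universe w v u


/-! ## The 2-category of symmetric monoidal categories -/

/-- A (bundled) symmetric monoidal category. -/
structure SymMonCat : Type (max (u + 1) (v + 1)) where
  carrier : Type u
  [category : Category.{v} carrier]
  [monoidal : MonoidalCategory carrier]
  [symmetric : SymmetricCategory carrier]

namespace SymMonCat

instance : CoeSort SymMonCat.{v, u} (Type u) := ⟨carrier⟩

attribute [instance] category monoidal symmetric

/-- A strong symmetric monoidal functor: a functor together with invertible coherence morphisms
`𝟙_ ≅ F 𝟙_` and `F X ⊗ F Y ≅ F (X ⊗ Y)` that are natural and compatible with the associators,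
the unitors and the braidings. -/
structure StrongFunctor (C D : SymMonCat.{v, u}) where
  functor : C ⥤ D
  [braided : functor.Braided]

attribute [instance] StrongFunctor.braided

/-- A monoidal natural transformation between strong symmetric monoidal functors. -/
structure MonoidalTrans {C D : SymMonCat.{v, u}} (F G : StrongFunctor C D) where
  natTrans : F.functor ⟶ G.functor
  [isMonoidal : NatTrans.IsMonoidal natTrans]

attribute [instance] MonoidalTrans.isMonoidal

/-- The category of strong symmetric monoidal functors and monoidal natural transformations. -/
instance (C D : SymMonCat.{v, u}) : Category (StrongFunctor C D) where
  Hom F G := MonoidalTrans F G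
  id F := { natTrans := 𝟙 F.functor }
  comp α β := { natTrans := α.natTrans ≫ β.natTrans }
  id_comp α := by cases α; simp
  comp_id α := by cases α; simp
  assoc α β γ := by simp

section

variable {C D : SymMonCat.{v, u}}

@[ext]
lemma trans_ext {F G : StrongFunctor C D} {α β : F ⟶ G}
    (h : ∀ X, α.natTrans.app X = β.natTrans.app X) : α = β := by
  obtain ⟨α⟩ := α
  obtain ⟨β⟩ := β
  obtain rfl : α = β := NatTrans.ext (funext h)
  rfl

@[simp]
lemma id_natTrans (F : StrongFunctor C D) : MonoidalTrans.natTrans (𝟙 F) = 𝟙 F.functor := rfl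

@[simp]
lemma comp_natTrans {F G H : StrongFunctor C D} (α : F ⟶ G) (β : G ⟶ H) :
    (α ≫ β).natTrans = α.natTrans ≫ β.natTrans := rfl

/-- A monoidal natural isomorphism of functors, as an isomorphism of strong functors. -/
def mkIso {F G : StrongFunctor C D} (e : F.functor ≅ G.functor)
    [m : NatTrans.IsMonoidal e.hom] : F ≅ G where
  hom := { natTrans := e.hom }
  inv := { natTrans := e.inv }
  hom_inv_id := by ext; simp
  inv_hom_id := by ext; simp

end

/-- The identity strong functor. -/
def idFunctor (C : SymMonCat.{v, u}) : StrongFunctor C C where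
  functor := 𝟭 C

/-- The composite of two strong functors, with the composite coherence morphisms. -/
def compFunctor {C D E : SymMonCat.{v, u}} (F : StrongFunctor C D) (G : StrongFunctor D E) :
    StrongFunctor C E where
  functor := F.functor ⋙ G.functor

/-- Whiskering of a monoidal transformation by a strong functor on the left. -/
def whiskerLeftTrans {C D E : SymMonCat.{v, u}} (F : StrongFunctor C D) {G H : StrongFunctor D E}
    (α : G ⟶ H) : compFunctor F G ⟶ compFunctor F H :=
  MonoidalTrans.mk (Functor.whiskerLeft F.functor α.natTrans)
    (isMonoidal := NatTrans.IsMonoidal.whiskerLeft _)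

/-- Whiskering of a monoidal transformation by a strong functor on the right. -/
def whiskerRightTrans {C D E : SymMonCat.{v, u}} {F G : StrongFunctor C D} (α : F ⟶ G)
    (H : StrongFunctor D E) : compFunctor F H ⟶ compFunctor G H :=
  MonoidalTrans.mk (Functor.whiskerRight α.natTrans H.functor)
    (isMonoidal := NatTrans.IsMonoidal.whiskerRight _)

section

variable {C D E E' : Type*} [Category* C] [Category* D] [Category* E] [Category* E']
  [MonoidalCategory C] [MonoidalCategory D] [MonoidalCategory E] [MonoidalCategory E']

lemma isMonoidal_leftUnitor (F : C ⥤ D) [F.LaxMonoidal] :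
    NatTrans.IsMonoidal F.leftUnitor.hom := inferInstance

lemma isMonoidal_rightUnitor (F : C ⥤ D) [F.LaxMonoidal] :
    NatTrans.IsMonoidal F.rightUnitor.hom := inferInstance

lemma isMonoidal_associator (F : C ⥤ D) (G : D ⥤ E) (H : E ⥤ E') [F.LaxMonoidal]
    [G.LaxMonoidal] [H.LaxMonoidal] :
    NatTrans.IsMonoidal (Functor.associator F G H).hom := inferInstance

end

/-- The 2-category of symmetric monoidal categories, strong symmetric monoidal functors and
monoidal natural transformations. -/
instance : Bicategory SymMonCat.{v, u} where
  Hom C D := StrongFunctor C D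
  id C := idFunctor C
  comp F G := compFunctor F G
  whiskerLeft F _ _ α := whiskerLeftTrans F α
  whiskerRight α F := whiskerRightTrans α F
  associator F G H := mkIso (F := compFunctor (compFunctor F G) H)
    (G := compFunctor F (compFunctor G H)) (Functor.associator F.functor G.functor H.functor)
    (m := isMonoidal_associator _ _ _)
  leftUnitor F := mkIso (F := compFunctor (idFunctor _) F) (G := F) F.functor.leftUnitor
    (m := isMonoidal_leftUnitor _)
  rightUnitor F := mkIso (F := compFunctor F (idFunctor _)) (G := F) F.functor.rightUnitor
    (m := isMonoidal_rightUnitor _)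
  whiskerLeft_id _ _ := by ext; simp [mkIso, compFunctor, idFunctor, whiskerLeftTrans, whiskerRightTrans]
  whiskerLeft_comp _ _ _ _ _ _ := by ext; simp [mkIso, compFunctor, idFunctor, whiskerLeftTrans, whiskerRightTrans]
  id_whiskerLeft _ := by ext; simp [mkIso, compFunctor, idFunctor, whiskerLeftTrans, whiskerRightTrans]
  comp_whiskerLeft _ _ _ _ _ := by ext; simp [mkIso, compFunctor, idFunctor, whiskerLeftTrans, whiskerRightTrans]
  id_whiskerRight _ _ := by ext; simp [mkIso, compFunctor, idFunctor, whiskerLeftTrans, whiskerRightTrans]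
  comp_whiskerRight _ _ _ := by ext; simp [mkIso, compFunctor, idFunctor, whiskerLeftTrans, whiskerRightTrans]
  whiskerRight_id _ := by ext; simp [mkIso, compFunctor, idFunctor, whiskerLeftTrans, whiskerRightTrans]
  whiskerRight_comp _ _ _ := by ext; simp [mkIso, compFunctor, idFunctor, whiskerLeftTrans, whiskerRightTrans]
  whisker_assoc _ _ _ _ _ := by ext; simp [mkIso, compFunctor, idFunctor, whiskerLeftTrans, whiskerRightTrans]
  whisker_exchange _ _ := by ext; simp [mkIso, compFunctor, idFunctor, whiskerLeftTrans, whiskerRightTrans]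
  pentagon _ _ _ _ := by ext; simp [mkIso, compFunctor, idFunctor, whiskerLeftTrans, whiskerRightTrans]
  triangle _ _ := by ext; simp [mkIso, compFunctor, idFunctor, whiskerLeftTrans, whiskerRightTrans]


lemma strongFunctor_ext {C D : SymMonCat.{v, u}} {F : C ⥤ D} (hF hG : F.Braided)
    (hε : hF.toLaxMonoidal.ε = hG.toLaxMonoidal.ε)
    (hμ : ∀ X Y, hF.toLaxMonoidal.μ X Y = hG.toLaxMonoidal.μ X Y) :
    StrongFunctor.mk F (braided := hF) = StrongFunctor.mk F (braided := hG) := by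
  have : hF.toMonoidal = hG.toMonoidal := by
    apply Functor.Monoidal.toLaxMonoidal_injective
    ext X Y
    · exact hε
    · exact hμ X Y
  cases hF
  cases hG
  dsimp only at this
  subst this
  rfl

lemma eqToHom_natTrans_app {C D : SymMonCat.{v, u}} {F G : StrongFunctor C D} (h : F = G) (X : C) :
    (MonoidalTrans.natTrans (eqToHom h)).app X = eqToHom (congrArg (fun K => K.functor.obj X) h) := by
  subst h
  rfl

lemma eq_eqToIso {C D : SymMonCat.{v, u}} {F G : StrongFunctor C D} (e : F ≅ G) (h : F = G)
    (w : ∀ X, e.hom.natTrans.app X = eqToHom (congrArg (fun K => K.functor.obj X) h)) :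
    e = eqToIso h := by
  apply Iso.ext
  apply trans_ext
  intro X
  rw [eqToIso.hom, eqToHom_natTrans_app, w]

open Functor.LaxMonoidal in
instance : Bicategory.Strict SymMonCat.{v, u} where
  id_comp {a b} F := strongFunctor_ext _ _
    (show ε F.functor ≫ F.functor.map (𝟙 (𝟙_ a)) = ε F.functor by simp)
    (fun X Y => show μ F.functor X Y ≫ F.functor.map (𝟙 (X ⊗ Y)) = μ F.functor X Y by simp)
  comp_id {a b} F := strongFunctor_ext _ _
    (show 𝟙 (𝟙_ b) ≫ ε F.functor = ε F.functor by simp)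
    (fun X Y => show 𝟙 (F.functor.obj X ⊗ F.functor.obj Y) ≫ μ F.functor X Y = μ F.functor X Y
      by simp)
  assoc F G H := strongFunctor_ext _ _
    (show ε H.functor ≫ H.functor.map (ε G.functor ≫ G.functor.map (ε F.functor)) =
      (ε H.functor ≫ H.functor.map (ε G.functor)) ≫ H.functor.map (G.functor.map (ε F.functor))
      by simp)
    (fun X Y => show μ H.functor _ _ ≫ H.functor.map (μ G.functor _ _ ≫
        G.functor.map (μ F.functor X Y)) =
      (μ H.functor _ _ ≫ H.functor.map (μ G.functor _ _)) ≫
        H.functor.map (G.functor.map (μ F.functor X Y)) by simp)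
  leftUnitor_eqToIso F := eq_eqToIso _ _ fun _ => rfl
  rightUnitor_eqToIso F := eq_eqToIso _ _ fun _ => rfl
  associator_eqToIso F G H := eq_eqToIso _ _ fun _ => rfl

end SymMonCat

/-! ## Strict products and coproducts in a 2-category -/

section Universal

open Bicategory

variable {B : Type*} [Bicategory B] {J : Type*}

/-- The functor `B(X, P) ⥤ ∏ j, B(X, A j)` given by composition with a family of 1-morphisms
`π j : P ⟶ A j`. -/
def coneComparison {A : J → B} {P : B} (π : ∀ j, P ⟶ A j) (X : B) :
    (X ⟶ P) ⥤ (∀ j, X ⟶ A j) :=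
  Functor.pi' fun j => postcomp X (π j)

/-- The functor `B(S, X) ⥤ ∏ j, B(A j, X)` given by composition with a family of 1-morphisms
`ι j : A j ⟶ S`. -/
def coconeComparison {A : J → B} {S : B} (ι : ∀ j, A j ⟶ S) (X : B) :
    (S ⟶ X) ⥤ (∀ j, A j ⟶ X) :=
  Functor.pi' fun j => precomp X (ι j)

/-- `P` with the projections `π j` is a strict product: for every object `X`, the functor
`B(X, P) ⥤ ∏ j, B(X, A j)` is an isomorphism of categories. -/
def IsStrictTwoProduct {A : J → B} {P : B} (π : ∀ j, P ⟶ A j) : Prop :=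
  ∀ X : B, ∃ G : (∀ j, X ⟶ A j) ⥤ (X ⟶ P),
    coneComparison π X ⋙ G = 𝟭 (X ⟶ P) ∧ G ⋙ coneComparison π X = 𝟭 (∀ j, X ⟶ A j)

/-- `S` with the coprojections `ι j` is a 2-coproduct: for every object `X`, the functor
`B(S, X) ⥤ ∏ j, B(A j, X)` is an equivalence of categories. -/
def IsTwoCoproduct {A : J → B} {S : B} (ι : ∀ j, A j ⟶ S) : Prop :=
  ∀ X : B, (coconeComparison ι X).IsEquivalence

end Universal

namespace SymMonCat

/-! ## Products -/

section Product

variable {J : Type w}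

/-- The pointwise monoidal structure on a product of categories. -/
instance piMonoidal (C : J → Type u) [∀ j, Category.{v} (C j)] [∀ j, MonoidalCategory (C j)] :
    MonoidalCategory (∀ j, C j) where
  tensorObj X Y j := X j ⊗ Y j
  whiskerLeft X _ _ f j := X j ◁ f j
  whiskerRight f Y j := f j ▷ Y j
  tensorHom f g j := f j ⊗ₘ g j
  tensorUnit j := 𝟙_ (C j)
  associator X Y Z := Pi.isoMk fun j => α_ (X j) (Y j) (Z j)
  leftUnitor X := Pi.isoMk fun j => λ_ (X j)
  rightUnitor X := Pi.isoMk fun j => ρ_ (X j)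
  tensorHom_def _ _ := by ext j; simp [MonoidalCategory.tensorHom_def]

/-- The pointwise symmetry on a product of symmetric monoidal categories. -/
instance piSymmetric (C : J → Type u) [∀ j, Category.{v} (C j)] [∀ j, MonoidalCategory (C j)]
    [∀ j, SymmetricCategory (C j)] : SymmetricCategory (∀ j, C j) where
  braiding X Y := Pi.isoMk fun j => β_ (X j) (Y j)

/-- The evaluation functors of a product are strict monoidal and preserve the symmetry. -/
instance piEvalBraided (C : J → Type u) [∀ j, Category.{v} (C j)] [∀ j, MonoidalCategory (C j)]
    [∀ j, SymmetricCategory (C j)] (j : J) : (Pi.eval C j).Braided where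
  toMonoidal := Functor.CoreMonoidal.toMonoidal
    { εIso := Iso.refl (𝟙_ (C j))
      μIso X Y := Iso.refl (X j ⊗ Y j)
      μIso_hom_natural_left f Y := (Category.comp_id (f j ▷ Y j)).trans (Category.id_comp _).symm
      μIso_hom_natural_right X f := (Category.comp_id (X j ◁ f j)).trans (Category.id_comp _).symm
      associativity X Y Z := show 𝟙 (X j ⊗ Y j) ▷ Z j ≫ 𝟙 ((X j ⊗ Y j) ⊗ Z j) ≫
        (α_ (X j) (Y j) (Z j)).hom = (α_ (X j) (Y j) (Z j)).hom ≫ X j ◁ 𝟙 (Y j ⊗ Z j) ≫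
          𝟙 (X j ⊗ Y j ⊗ Z j) by simp
      left_unitality X := show (λ_ (X j)).hom = 𝟙 (𝟙_ (C j)) ▷ X j ≫ 𝟙 (𝟙_ (C j) ⊗ X j) ≫
        (λ_ (X j)).hom by simp
      right_unitality X := show (ρ_ (X j)).hom = X j ◁ 𝟙 (𝟙_ (C j)) ≫ 𝟙 (X j ⊗ 𝟙_ (C j)) ≫
        (ρ_ (X j)).hom by simp }
  braided X Y := (Category.id_comp (β_ (X j) (Y j)).hom).trans (Category.comp_id _).symm

/-- The product of a family of symmetric monoidal categories: the product category with the
pointwise symmetric monoidal structure. -/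
def prod (C : J → SymMonCat.{v, u}) : SymMonCat.{max w v, max w u} where
  carrier := ∀ j, C j

/-- The projections from the product; they are strict monoidal. -/
def proj (C : J → SymMonCat.{max w v, max w u}) (j : J) : prod C ⟶ C j :=
  StrongFunctor.mk (C := prod C) (D := C j) (Pi.eval (fun j => C j) j)
    (braided := piEvalBraided _ j)

end Product

/-! ## Coproducts -/

section StrictTensor

variable {C : Type u} [Category.{v} C] [MonoidalCategory C]

open Classical in
/-- The tensor product of two objects, with `𝟙_ ⊗ 𝟙_` replaced by `𝟙_`. -/
noncomputable def unitTensor (X Y : C) : C :=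
  if X = 𝟙_ C ∧ Y = 𝟙_ C then 𝟙_ C else X ⊗ Y

lemma unitTensor_unit {X Y : C} (hX : X = 𝟙_ C) (hY : Y = 𝟙_ C) : unitTensor X Y = 𝟙_ C :=
  if_pos ⟨hX, hY⟩

open Classical in
/-- The canonical isomorphism `X ⊗ Y ≅ unitTensor X Y`: the unitor if `X = Y = 𝟙_`, and the
identity otherwise. -/
noncomputable def unitTensorIso (X Y : C) : X ⊗ Y ≅ unitTensor X Y :=
  if h : X = 𝟙_ C ∧ Y = 𝟙_ C then
    (eqToIso h.1 ⊗ᵢ eqToIso h.2) ≪≫ λ_ (𝟙_ C) ≪≫ eqToIso (unitTensor_unit h.1 h.2).symm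
  else eqToIso (if_neg h).symm

/-- A morphism is a unit identity if it is the identity morphism of the monoidal unit. -/
def IsUnitId {X Y : C} (f : X ⟶ Y) : Prop :=
  ∃ (hX : X = 𝟙_ C) (hY : Y = 𝟙_ C), f = eqToHom (hX.trans hY.symm)

lemma isUnitId_id {X : C} (h : X = 𝟙_ C) : IsUnitId (𝟙 X) := ⟨h, h, rfl⟩

lemma IsUnitId.comp {X Y Z : C} {f : X ⟶ Y} {g : Y ⟶ Z} (hf : IsUnitId f) (hg : IsUnitId g) :
    IsUnitId (f ≫ g) := by
  obtain ⟨rfl, rfl, rfl⟩ := hf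
  obtain ⟨_, rfl, rfl⟩ := hg
  exact ⟨rfl, rfl, by simp⟩

lemma unitTensorIso_unit {X Y : C} (hX : X = 𝟙_ C) (hY : Y = 𝟙_ C) :
    (unitTensorIso X Y).hom = (eqToHom hX ⊗ₘ eqToHom hY) ≫ (λ_ (𝟙_ C)).hom ≫
      eqToHom (unitTensor_unit hX hY).symm := by
  simp [unitTensorIso, hX, hY]

lemma unitTensorIso_unit_inv {X Y : C} (hX : X = 𝟙_ C) (hY : Y = 𝟙_ C) :
    (unitTensorIso X Y).inv = eqToHom (unitTensor_unit hX hY) ≫ (λ_ (𝟙_ C)).inv ≫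
      (eqToHom hX.symm ⊗ₘ eqToHom hY.symm) := by
  simp [unitTensorIso, hX, hY]

lemma isUnitId_tensor {X X' Y Y' : C} {f : X ⟶ X'} {g : Y ⟶ Y'} (hf : IsUnitId f)
    (hg : IsUnitId g) :
    IsUnitId ((unitTensorIso X Y).inv ≫ (f ⊗ₘ g) ≫ (unitTensorIso X' Y').hom) := by
  obtain ⟨rfl, rfl, rfl⟩ := hf
  obtain ⟨rfl, rfl, rfl⟩ := hg
  exact ⟨unitTensor_unit rfl rfl, unitTensor_unit rfl rfl, by simp⟩

lemma isUnitId_whiskerRight {X X' Y : C} {f : X ⟶ X'} (hf : IsUnitId f) (hY : Y = 𝟙_ C) :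
    IsUnitId ((unitTensorIso X Y).inv ≫ (f ▷ Y) ≫ (unitTensorIso X' Y).hom) := by
  simpa using isUnitId_tensor hf (isUnitId_id hY)

lemma isUnitId_whiskerLeft {X Y Y' : C} {f : Y ⟶ Y'} (hX : X = 𝟙_ C) (hf : IsUnitId f) :
    IsUnitId ((unitTensorIso X Y).inv ≫ (X ◁ f) ≫ (unitTensorIso X Y').hom) := by
  simpa using isUnitId_tensor (isUnitId_id hX) hf

/-- The associator for `unitTensor`. -/
noncomputable def unitAssoc (X Y Z : C) :
    unitTensor (unitTensor X Y) Z ≅ unitTensor X (unitTensor Y Z) :=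
  ((unitTensorIso _ _).symm ≪≫ ((unitTensorIso _ _).symm ⊗ᵢ .refl _)) ≪≫ α_ X Y Z ≪≫
    ((.refl _ ⊗ᵢ unitTensorIso _ _) ≪≫ unitTensorIso _ _)

/-- The left unitor for `unitTensor`. -/
noncomputable def unitLeftUnitor (X : C) : unitTensor (𝟙_ C) X ≅ X :=
  (unitTensorIso _ _).symm ≪≫ λ_ X

/-- The right unitor for `unitTensor`. -/
noncomputable def unitRightUnitor (X : C) : unitTensor X (𝟙_ C) ≅ X :=
  (unitTensorIso _ _).symm ≪≫ ρ_ X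

/-- The braiding for `unitTensor`. -/
noncomputable def unitBraiding [BraidedCategory C] (X Y : C) : unitTensor X Y ≅ unitTensor Y X :=
  (unitTensorIso _ _).symm ≪≫ β_ X Y ≪≫ unitTensorIso _ _

lemma IsUnitId.inv {X Y : C} {f : X ≅ Y} (hf : IsUnitId f.hom) : IsUnitId f.inv := by
  obtain ⟨f, g, h, h'⟩ := f
  obtain ⟨rfl, rfl, rfl⟩ := hf
  exact ⟨rfl, rfl, by simpa using h⟩

lemma unitAssoc_aux {W V V' : C} (h : W = 𝟙_ C) (hV : V = 𝟙_ C) (hV' : V' = 𝟙_ C)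
    (a : 𝟙_ C ⊗ 𝟙_ C ≅ W) (b : W ⊗ 𝟙_ C ≅ V) (c : 𝟙_ C ⊗ W ≅ V')
    (ha : a.hom = (eqToHom rfl ⊗ₘ eqToHom rfl) ≫ (λ_ (𝟙_ C)).hom ≫ eqToHom h.symm)
    (hb : b.hom = (eqToHom h ⊗ₘ eqToHom rfl) ≫ (λ_ (𝟙_ C)).hom ≫ eqToHom hV.symm)
    (hc : c.hom = (eqToHom rfl ⊗ₘ eqToHom h) ≫ (λ_ (𝟙_ C)).hom ≫ eqToHom hV'.symm) :
    ((b.symm ≪≫ (a.symm ⊗ᵢ .refl _)) ≪≫ α_ (𝟙_ C) (𝟙_ C) (𝟙_ C) ≪≫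
      ((.refl _ ⊗ᵢ a) ≪≫ c)).hom = eqToHom (hV.trans hV'.symm) := by
  subst h hV hV'
  obtain rfl : a = λ_ (𝟙_ C) := by ext; simpa using ha
  obtain rfl : b = λ_ (𝟙_ C) := by ext; simpa using hb
  obtain rfl : c = λ_ (𝟙_ C) := by ext; simpa using hc
  have e : (λ_ (𝟙_ C)).hom ▷ 𝟙_ C = (α_ (𝟙_ C) (𝟙_ C) (𝟙_ C)).hom ≫ 𝟙_ C ◁ (λ_ (𝟙_ C)).hom := by
    rw [MonoidalCategory.triangle, unitors_equal]
  simp only [Iso.trans_hom, Iso.symm_hom, tensorIso_hom, Iso.refl_hom, Category.assoc,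
    tensorHom_id, id_tensorHom, eqToHom_refl]
  rw [← reassoc_of% e]
  simp

lemma isUnitId_assoc {X Y Z : C} (hX : X = 𝟙_ C) (hY : Y = 𝟙_ C) (hZ : Z = 𝟙_ C) :
    IsUnitId (unitAssoc X Y Z).hom := by
  refine ⟨unitTensor_unit (unitTensor_unit hX hY) hZ,
    unitTensor_unit hX (unitTensor_unit hY hZ), ?_⟩
  subst hX hY hZ
  have h := unitTensor_unit (C := C) rfl rfl
  exact unitAssoc_aux h (unitTensor_unit h rfl) (unitTensor_unit rfl h) _ _ _
    (unitTensorIso_unit rfl rfl) (unitTensorIso_unit h rfl)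
    (unitTensorIso_unit rfl h)

lemma isUnitId_leftUnitor {X : C} (hX : X = 𝟙_ C) : IsUnitId (unitLeftUnitor X).hom := by
  subst hX
  exact ⟨unitTensor_unit rfl rfl, rfl, by simp [unitLeftUnitor, unitTensorIso_unit_inv]⟩

lemma isUnitId_rightUnitor {X : C} (hX : X = 𝟙_ C) : IsUnitId (unitRightUnitor X).hom := by
  subst hX
  exact ⟨unitTensor_unit rfl rfl, rfl, by
    simp [unitRightUnitor, unitTensorIso_unit_inv, unitors_inv_equal]⟩

lemma isUnitId_braiding [BraidedCategory C] {X Y : C} (hX : X = 𝟙_ C) (hY : Y = 𝟙_ C) :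
    IsUnitId (unitBraiding X Y).hom := by
  subst hX hY
  exact ⟨unitTensor_unit rfl rfl, unitTensor_unit rfl rfl, by
    simp [unitBraiding, unitTensorIso_unit_inv, unitTensorIso_unit]
    rw [← unitors_equal]
    simp⟩

end StrictTensor

section Coproduct

variable {J : Type w}

open Filter

/-- The objects of the coproduct: families of objects `c j`, with `c j = 𝟙_` for all but finitely
many `j`. -/
structure CoprodObj (C : J → SymMonCat.{v, u}) : Type (max w u) where
  obj : ∀ j, C j
  finite : ∀ᶠ j in cofinite, obj j = 𝟙_ (C j)

namespace CoprodObj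

variable {C : J → SymMonCat.{v, u}}

/-- The morphisms of the coproduct: families of morphisms `f j : c j ⟶ d j`, with `f j` the
identity of `𝟙_` for all but finitely many `j`. -/
@[ext]
structure Hom (c d : CoprodObj C) : Type (max w v) where
  app : ∀ j, c.obj j ⟶ d.obj j
  finite : ∀ᶠ j in cofinite, IsUnitId (app j)

instance : Category (CoprodObj C) where
  Hom := Hom
  id c := ⟨fun j => 𝟙 (c.obj j), c.finite.mono fun _ => isUnitId_id⟩
  comp f g := ⟨fun j => f.app j ≫ g.app j, by
    filter_upwards [f.finite, g.finite] with j hf hg using hf.comp hg⟩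

@[ext]
lemma hom_ext {c d : CoprodObj C} {f g : c ⟶ d} (h : ∀ j, f.app j = g.app j) : f = g :=
  Hom.ext (funext h)

@[simp]
lemma id_app (c : CoprodObj C) (j : J) : Hom.app (𝟙 c) j = 𝟙 (c.obj j) := rfl

@[simp]
lemma comp_app {c d e : CoprodObj C} (f : c ⟶ d) (g : d ⟶ e) (j : J) :
    (f ≫ g).app j = f.app j ≫ g.app j := rfl

/-- A finitely supported family of isomorphisms is an isomorphism. -/
@[simps]
def mkIso {c d : CoprodObj C} (e : ∀ j, c.obj j ≅ d.obj j)
    (h : ∀ᶠ j in cofinite, IsUnitId (e j).hom) : c ≅ d where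
  hom := ⟨fun j => (e j).hom, h⟩
  inv := ⟨fun j => (e j).inv, h.mono fun _ => IsUnitId.inv⟩

/-- The pointwise tensor product, unit, associator and unitors, with `𝟙_ ⊗ 𝟙_` replaced
by `𝟙_`. -/
noncomputable instance : MonoidalCategoryStruct (CoprodObj C) where
  tensorObj c d := ⟨fun j => unitTensor (c.obj j) (d.obj j), by
    filter_upwards [c.finite, d.finite] with j using unitTensor_unit⟩
  whiskerLeft c _ _ f :=
    ⟨fun j => (unitTensorIso _ _).inv ≫ (c.obj j ◁ f.app j) ≫ (unitTensorIso _ _).hom, by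
      filter_upwards [c.finite, f.finite] with j using isUnitId_whiskerLeft⟩
  whiskerRight f d :=
    ⟨fun j => (unitTensorIso _ _).inv ≫ (f.app j ▷ d.obj j) ≫ (unitTensorIso _ _).hom, by
      filter_upwards [f.finite, d.finite] with j using isUnitId_whiskerRight⟩
  tensorHom f g :=
    ⟨fun j => (unitTensorIso _ _).inv ≫ (f.app j ⊗ₘ g.app j) ≫ (unitTensorIso _ _).hom, by
      filter_upwards [f.finite, g.finite] with j using isUnitId_tensor⟩
  tensorUnit := ⟨fun j => 𝟙_ (C j), Eventually.of_forall fun _ => rfl⟩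
  associator c d e := mkIso (fun j => unitAssoc (c.obj j) (d.obj j) (e.obj j)) (by
    filter_upwards [c.finite, d.finite, e.finite] with j using isUnitId_assoc)
  leftUnitor c := mkIso (fun j => unitLeftUnitor (c.obj j)) (by
    filter_upwards [c.finite] with j using isUnitId_leftUnitor)
  rightUnitor c := mkIso (fun j => unitRightUnitor (c.obj j)) (by
    filter_upwards [c.finite] with j using isUnitId_rightUnitor)

/-- The inclusion of the coproduct in the product. -/
@[simps]
def toPi (C : J → SymMonCat.{v, u}) : CoprodObj C ⥤ ∀ j, C j where
  obj c := c.obj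
  map f := f.app

instance : (toPi C).Faithful where
  map_injective h := hom_ext (congrFun h)

/-- The comparison of the tensor products of the coproduct and the product. -/
noncomputable def toPiData (C : J → SymMonCat.{v, u}) :
    Monoidal.InducingFunctorData (toPi C) where
  μIso c d := Pi.isoMk fun j => unitTensorIso (c.obj j) (d.obj j)
  εIso := Iso.refl _
  whiskerLeft_eq _ _ _ _ := rfl
  whiskerRight_eq _ _ := rfl
  tensorHom_eq _ _ := rfl
  associator_eq _ _ _ := rfl
  leftUnitor_eq c := by
    ext j
    change (unitTensorIso (𝟙_ (C j)) (c.obj j)).inv ≫ (λ_ (c.obj j)).hom =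
      ((unitTensorIso (𝟙_ (C j)) (c.obj j)).inv ≫ (𝟙 (𝟙_ (C j)) ⊗ₘ 𝟙 (c.obj j))) ≫
        (λ_ (c.obj j)).hom
    simp
  rightUnitor_eq c := by
    ext j
    change (unitTensorIso (c.obj j) (𝟙_ (C j))).inv ≫ (ρ_ (c.obj j)).hom =
      ((unitTensorIso (c.obj j) (𝟙_ (C j))).inv ≫ (𝟙 (c.obj j) ⊗ₘ 𝟙 (𝟙_ (C j)))) ≫
        (ρ_ (c.obj j)).hom
    simp

noncomputable instance : MonoidalCategory (CoprodObj C) :=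
  Monoidal.induced (toPi C) (toPiData C)

noncomputable instance : (toPi C).Monoidal :=
  Monoidal.fromInducedMonoidal (toPi C) (toPiData C)

/-- The pointwise braiding. -/
noncomputable instance : BraidedCategory (CoprodObj C) :=
  BraidedCategory.ofFaithful (toPi C)
    (fun c d => mkIso (fun j => unitBraiding (c.obj j) (d.obj j)) (by
      filter_upwards [c.finite, d.finite] with j using isUnitId_braiding)) (fun c d => by
      ext j
      exact Iso.hom_inv_id_assoc (unitTensorIso (c.obj j) (d.obj j))
        ((β_ (c.obj j) (d.obj j)).hom ≫ (unitTensorIso (d.obj j) (c.obj j)).hom))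

noncomputable instance : SymmetricCategory (CoprodObj C) where
  symmetry c d := by
    ext j
    change (unitBraiding (c.obj j) (d.obj j)).hom ≫ (unitBraiding (d.obj j) (c.obj j)).hom =
      𝟙 (unitTensor (c.obj j) (d.obj j))
    simp [unitBraiding]

end CoprodObj

/-- The coproduct of a family of symmetric monoidal categories: the symmetric monoidal category of
finitely supported families of objects. -/
noncomputable def coprod (C : J → SymMonCat.{v, u}) : SymMonCat.{max w v, max w u} where
  carrier := CoprodObj C

/-- The strong functor that is constant at the monoidal unit. -/
def unitFunctor (C D : SymMonCat.{v, u}) : StrongFunctor C D where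
  functor := (Functor.const C).obj (𝟙_ D)
  braided :=
    { toMonoidal := Functor.CoreMonoidal.toMonoidal
        { εIso := Iso.refl _
          μIso _ _ := λ_ (𝟙_ D)
          associativity _ _ _ := by
            simp only [Functor.const_obj_obj, Functor.const_obj_map, Category.comp_id]
            rw [MonoidalCategory.triangle_assoc, unitors_equal]
          right_unitality _ := by simp [unitors_equal] }
      braided _ _ := by
        change (λ_ (𝟙_ D)).hom ≫ 𝟙 (𝟙_ D) = (β_ (𝟙_ D) (𝟙_ D)).hom ≫ (λ_ (𝟙_ D)).hom
        rw [braiding_leftUnitor, Category.comp_id, unitors_equal] }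

lemma isUnitId_ε {C D : SymMonCat.{v, u}} {F : StrongFunctor C D} (hF : F = unitFunctor C D) :
    IsUnitId (Functor.LaxMonoidal.ε F.functor) := by
  subst hF
  exact ⟨rfl, rfl, rfl⟩

lemma isUnitId_μ {C D : SymMonCat.{v, u}} {F : StrongFunctor C D} (hF : F = unitFunctor C D)
    (X Y : C) :
    IsUnitId ((unitTensorIso _ _).inv ≫ Functor.LaxMonoidal.μ F.functor X Y) := by
  subst hF
  refine ⟨unitTensor_unit rfl rfl, rfl, ?_⟩
  change (unitTensorIso (𝟙_ D) (𝟙_ D)).inv ≫ (λ_ (𝟙_ D)).hom = _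
  simp [unitTensorIso_unit_inv]
  rfl

lemma isUnitId_map {C D : SymMonCat.{v, u}} {F : StrongFunctor C D} (hF : F = unitFunctor C D)
    {X Y : C} (f : X ⟶ Y) : IsUnitId (F.functor.map f) := by
  subst hF
  exact ⟨rfl, rfl, rfl⟩

open Functor.LaxMonoidal in
/-- A family of strong functors, all but finitely many of which are constant at the unit, induces a
strong functor to the coproduct. -/
noncomputable def toCoprod {C : J → SymMonCat.{max w v, max w u}} {A : SymMonCat.{max w v, max w u}}
    (F : ∀ j, StrongFunctor A (C j)) (hF : ∀ᶠ j in cofinite, F j = unitFunctor A (C j)) :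
    StrongFunctor A (coprod C) :=
  StrongFunctor.mk (C := A) (D := coprod C)
    { obj X := CoprodObj.mk (fun j => (F j).functor.obj X) (hF.mono fun _ h => by rw [h]; rfl)
      map f := CoprodObj.Hom.mk (fun j => (F j).functor.map f) (hF.mono fun _ h => isUnitId_map h f)
      map_id X := by apply CoprodObj.hom_ext; intro j; exact (F j).functor.map_id X
      map_comp f g := by apply CoprodObj.hom_ext; intro j; exact (F j).functor.map_comp f g }
    (braided :=
      { toMonoidal := Functor.CoreMonoidal.toMonoidal
          { εIso := CoprodObj.mkIso (fun j => Functor.Monoidal.εIso (F j).functor)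
              (hF.mono fun _ h => isUnitId_ε h)
            μIso X Y := CoprodObj.mkIso
              (fun j => (unitTensorIso _ _).symm ≪≫ Functor.Monoidal.μIso (F j).functor X Y)
              (hF.mono fun _ h => isUnitId_μ h X Y)
            μIso_hom_natural_left {X Y} f Z := by
              apply CoprodObj.hom_ext
              intro j
              let G := (F j).functor
              change ((unitTensorIso _ _).inv ≫ (G.map f ▷ G.obj Z) ≫ (unitTensorIso _ _).hom) ≫
                (unitTensorIso _ _).inv ≫ μ G Y Z =
                  ((unitTensorIso _ _).inv ≫ μ G X Z) ≫ G.map (f ▷ Z)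
              simp
            μIso_hom_natural_right {X Y} Z f := by
              apply CoprodObj.hom_ext
              intro j
              let G := (F j).functor
              change ((unitTensorIso _ _).inv ≫ (G.obj Z ◁ G.map f) ≫ (unitTensorIso _ _).hom) ≫
                (unitTensorIso _ _).inv ≫ μ G Z Y =
                  ((unitTensorIso _ _).inv ≫ μ G Z X) ≫ G.map (Z ◁ f)
              simp
            associativity X Y Z := by
              apply CoprodObj.hom_ext
              intro j
              let G := (F j).functor
              change ((unitTensorIso _ _).inv ≫ (((unitTensorIso _ _).inv ≫ μ G X Y) ▷ G.obj Z) ≫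
                  (unitTensorIso _ _).hom) ≫ ((unitTensorIso _ _).inv ≫ μ G (X ⊗ Y) Z) ≫
                    G.map (α_ X Y Z).hom =
                (unitAssoc (G.obj X) (G.obj Y) (G.obj Z)).hom ≫
                  ((unitTensorIso _ _).inv ≫ (G.obj X ◁ ((unitTensorIso _ _).inv ≫ μ G Y Z)) ≫
                    (unitTensorIso _ _).hom) ≫ ((unitTensorIso _ _).inv ≫ μ G X (Y ⊗ Z))
              simp [unitAssoc]
            left_unitality X := by
              apply CoprodObj.hom_ext
              intro j
              let G := (F j).functor
              change (unitLeftUnitor (G.obj X)).hom =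
                ((unitTensorIso _ _).inv ≫ (ε G ▷ G.obj X) ≫ (unitTensorIso _ _).hom) ≫
                  ((unitTensorIso _ _).inv ≫ μ G (𝟙_ A) X) ≫ G.map (λ_ X).hom
              simp [unitLeftUnitor]
            right_unitality X := by
              apply CoprodObj.hom_ext
              intro j
              let G := (F j).functor
              change (unitRightUnitor (G.obj X)).hom =
                ((unitTensorIso _ _).inv ≫ (G.obj X ◁ ε G) ≫ (unitTensorIso _ _).hom) ≫
                  ((unitTensorIso _ _).inv ≫ μ G X (𝟙_ A)) ≫ G.map (ρ_ X).hom
              simp [unitRightUnitor] }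
        braided X Y := by
          apply CoprodObj.hom_ext
          intro j
          let G := (F j).functor
          change ((unitTensorIso _ _).inv ≫ μ G X Y) ≫ G.map (β_ X Y).hom =
            (unitBraiding (G.obj X) (G.obj Y)).hom ≫ (unitTensorIso _ _).inv ≫ μ G Y X
          simp [unitBraiding] })

open Classical in
/-- The strong functor `C j ⥤ C k` that is the identity if `j = k` and constant at the unit
otherwise. -/
noncomputable def delta (C : J → SymMonCat.{v, u}) (j k : J) : StrongFunctor (C j) (C k) :=
  if h : j = k then h ▸ idFunctor (C j) else unitFunctor (C j) (C k)

lemma delta_of_ne (C : J → SymMonCat.{v, u}) {j k : J} (h : j ≠ k) :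
    delta C j k = unitFunctor (C j) (C k) := dif_neg h

lemma delta_self (C : J → SymMonCat.{v, u}) (j : J) : delta C j j = idFunctor (C j) :=
  dif_pos rfl

/-- The coprojections: `incl C j` sends `c` to the family with `c` at `j` and `𝟙_` elsewhere. -/
noncomputable def incl (C : J → SymMonCat.{max w v, max w u}) (j : J) : C j ⟶ coprod C :=
  toCoprod (delta C j) ((Set.finite_singleton j).subset fun _ hk =>
    by_contra fun h => hk (delta_of_ne C (Ne.symm h)))

end Coproduct

end SymMonCat

/-!
The hom-categories are monoidal under the pointwise tensor product, and composition is strong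
monoidal in each variable. So, as in a category enriched in commutative monoids, a finite product
with the injections that are the identity in one component and the unit functor in the others is
also a 2-categorical coproduct: every functor out of it is recovered from the isomorphism
`𝟙 ≅ ⨂ⱼ πⱼ ≫ inⱼ`.

For infinite `J`, the coproduct is the directed union, over the finite subsets `s` of `J`, of the
subcategories of morphisms supported in `s`, each of which is equivalent to a finite product.
Functors out of the coproduct are glued from functors on these subcategories. On the intersection of
two subcategories, the transition isomorphism is the unique one that is compatible with the given
isomorphisms on the summands, since restriction to the summands is fully faithful on each
subcategory. By this uniqueness the transition isomorphisms satisfy the cocycle condition.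
-/

namespace SymMonCat

section StrictProduct

open Functor.LaxMonoidal

lemma functor_ext_of_app {K : Type*} [Category* K] {A B : SymMonCat.{v, u}}
    {Φ Ψ : K ⥤ StrongFunctor A B} (hobj : ∀ k, Φ.obj k = Ψ.obj k)
    (hmap : ∀ ⦃k l : K⦄ (f : k ⟶ l) (X : A), (Φ.map f).natTrans.app X =
      eqToHom (congrArg (fun F => F.functor.obj X) (hobj k)) ≫ (Ψ.map f).natTrans.app X ≫
        eqToHom (congrArg (fun F => F.functor.obj X) (hobj l).symm)) : Φ = Ψ :=
  CategoryTheory.Functor.ext hobj fun k l f => by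
    ext X
    simpa only [comp_natTrans, NatTrans.comp_app, eqToHom_natTrans_app] using hmap f X

variable {J : Type w} {C : J → SymMonCat.{max w v, max w u}} {A : SymMonCat.{max w v, max w u}}

/-- The strong functor to the product whose components are the given strong functors. -/
def pair (F : ∀ j, StrongFunctor A (C j)) : StrongFunctor A (prod C) :=
  StrongFunctor.mk (C := A) (D := prod C) (Functor.pi' fun j => (F j).functor)
    (braided :=
      { toMonoidal := Functor.CoreMonoidal.toMonoidal
          { εIso := Pi.isoMk fun j => Functor.Monoidal.εIso (F j).functor
            μIso X Y := Pi.isoMk fun j => Functor.Monoidal.μIso (F j).functor X Y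
            μIso_hom_natural_left f Z := funext fun j => μ_natural_left (F j).functor f Z
            μIso_hom_natural_right Z f := funext fun j => μ_natural_right (F j).functor Z f
            associativity X Y Z := funext fun j => associativity (F j).functor X Y Z
            left_unitality X := funext fun j => left_unitality (F j).functor X
            right_unitality X := funext fun j => right_unitality (F j).functor X }
        braided X Y := funext fun j => Functor.LaxBraided.braided (F := (F j).functor) X Y })

/-- The monoidal transformation into a product whose components are the given transformations. -/
def pairTrans {F G : ∀ j, StrongFunctor A (C j)} (α : ∀ j, F j ⟶ G j) : pair F ⟶ pair G :=
  MonoidalTrans.mk (F := pair F) (G := pair G)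
    { app X := fun j => (α j).natTrans.app X
      naturality _ _ f := funext fun j => (α j).natTrans.naturality f }
    (isMonoidal :=
      { unit := funext fun j => NatTrans.IsMonoidal.unit (τ := (α j).natTrans)
        tensor X Y := funext fun j => NatTrans.IsMonoidal.tensor (τ := (α j).natTrans) X Y })

lemma pair_comp_proj (F : ∀ j, StrongFunctor A (C j)) (j : J) :
    compFunctor (pair F) (proj C j) = F j :=
  strongFunctor_ext (F := (F j).functor)
    (compFunctor (pair F) (proj C j)).braided (F j).braided
    (Category.id_comp (ε (F j).functor))
    (fun X Y => Category.id_comp (μ (F j).functor X Y))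

lemma pair_proj_comp (F : StrongFunctor A (prod C)) :
    pair (fun j => compFunctor F (proj C j)) = F :=
  strongFunctor_ext (C := A) (D := prod C) (F := F.functor)
    (pair (fun j => compFunctor F (proj C j))).braided F.braided
    (funext fun j => Category.id_comp (ε F.functor j))
    (fun X Y => funext fun j => Category.id_comp (μ F.functor X Y j))

theorem isStrictTwoProduct_proj (C : J → SymMonCat.{max w v, max w u}) :
    IsStrictTwoProduct (proj C) := fun _ =>
  ⟨{ obj := pair, map := pairTrans, map_id _ := rfl, map_comp _ _ := rfl },
    functor_ext_of_app pair_proj_comp fun _ _ _ _ =>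
      ((Category.id_comp _).trans (Category.comp_id _)).symm,
    Functor.pi_ext _ _ fun j => functor_ext_of_app (fun F => pair_comp_proj F j) fun _ _ _ _ =>
      ((Category.id_comp _).trans (Category.comp_id _)).symm⟩

end StrictProduct

section HomMonoidal

open Functor.LaxMonoidal

lemma tensorμ_comp_tensorHom_braiding {D : Type*} [Category* D] [MonoidalCategory D]
    [SymmetricCategory D] (W X Y Z : D) :
    tensorμ W X Y Z ≫ ((β_ W Y).hom ⊗ₘ (β_ X Z).hom) =
      (β_ (W ⊗ X) (Y ⊗ Z)).hom ≫ tensorμ Y Z W X := by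
  have h : Y ◁ (β_ W Z).hom ▷ X ≫ Y ◁ (β_ Z W).hom ▷ X = 𝟙 _ := by
    rw [← MonoidalCategory.whiskerLeft_comp, ← comp_whiskerRight, SymmetricCategory.symmetry]
    simp
  simp [tensorμ, MonoidalCategory.tensorHom_def, reassoc_of% h]

variable {A B D : SymMonCat.{v, u}}

/-- The pointwise tensor product of two strong functors. It is again symmetric monoidal because
the tensor product of a symmetric monoidal category is a symmetric monoidal functor. -/
def tensorFunctor (F G : StrongFunctor A B) : StrongFunctor A B where
  functor := F.functor.prod' G.functor ⋙ tensor B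
  braided :=
    { braided X Y := by
        simp [-BraidedCategory.braiding_tensor_left_hom, -BraidedCategory.braiding_tensor_right_hom,
          ← reassoc_of% tensorμ_comp_tensorHom_braiding] }

@[simp]
lemma tensorFunctor_obj (F G : StrongFunctor A B) (X : A) :
    (tensorFunctor F G).functor.obj X = F.functor.obj X ⊗ G.functor.obj X := rfl

@[simp]
lemma tensorFunctor_map (F G : StrongFunctor A B) {X Y : A} (f : X ⟶ Y) :
    (tensorFunctor F G).functor.map f = F.functor.map f ⊗ₘ G.functor.map f := rfl

@[simp]
lemma tensorFunctor_ε (F G : StrongFunctor A B) :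
    ε (tensorFunctor F G).functor = (λ_ (𝟙_ B)).inv ≫ (ε F.functor ⊗ₘ ε G.functor) :=
  (Functor.LaxMonoidal.comp_ε (F.functor.prod' G.functor) (tensor B)).trans (by simp)

@[simp]
lemma tensorFunctor_μ (F G : StrongFunctor A B) (X Y : A) :
    μ (tensorFunctor F G).functor X Y =
      tensorμ _ _ _ _ ≫ (μ F.functor X Y ⊗ₘ μ G.functor X Y) :=
  (Functor.LaxMonoidal.comp_μ (F.functor.prod' G.functor) (tensor B) X Y).trans (by simp)

@[simp]
lemma unitFunctor_obj (X : A) : (unitFunctor A B).functor.obj X = 𝟙_ B := rfl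

@[simp]
lemma unitFunctor_map {X Y : A} (f : X ⟶ Y) : (unitFunctor A B).functor.map f = 𝟙 (𝟙_ B) := rfl

@[simp]
lemma unitFunctor_ε : ε (unitFunctor A B).functor = 𝟙 (𝟙_ B) := rfl

@[simp]
lemma unitFunctor_μ (X Y : A) : μ (unitFunctor A B).functor X Y = (λ_ (𝟙_ B)).hom := rfl

/-- A monoidal isomorphism of strong functors from its components. -/
def isoOfComponents {F G : StrongFunctor A B} (e : ∀ X, F.functor.obj X ≅ G.functor.obj X)
    (naturality : ∀ {X Y : A} (f : X ⟶ Y),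
      F.functor.map f ≫ (e Y).hom = (e X).hom ≫ G.functor.map f)
    (unit : ε F.functor ≫ (e (𝟙_ A)).hom = ε G.functor)
    (tensor : ∀ X Y, μ F.functor X Y ≫ (e (X ⊗ Y)).hom =
      ((e X).hom ⊗ₘ (e Y).hom) ≫ μ G.functor X Y) : F ≅ G :=
  mkIso (NatIso.ofComponents e naturality) (m := ⟨unit, tensor⟩)

/-- The pointwise tensor product of two monoidal transformations. -/
def tensorTrans {F F' G G' : StrongFunctor A B} (α : F ⟶ F') (β : G ⟶ G') :
    tensorFunctor F G ⟶ tensorFunctor F' G' :=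
  MonoidalTrans.mk (Functor.whiskerRight (NatTrans.prod' α.natTrans β.natTrans) (tensor B))
    (isMonoidal := NatTrans.IsMonoidal.whiskerRight _)

/-- The associativity constraint of the pointwise tensor product. -/
def tensorAssociator (F G H : StrongFunctor A B) :
    tensorFunctor (tensorFunctor F G) H ≅ tensorFunctor F (tensorFunctor G H) :=
  isoOfComponents (fun X => α_ (F.functor.obj X) (G.functor.obj X) (H.functor.obj X))
    (fun f => associator_naturality (F.functor.map f) (G.functor.map f) (H.functor.map f))
    (by
      rw [tensorFunctor_ε, tensorFunctor_ε, tensorFunctor_ε, tensorFunctor_ε]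
      change ((λ_ (𝟙_ B)).inv ≫ (((λ_ (𝟙_ B)).inv ≫ (ε F.functor ⊗ₘ ε G.functor)) ⊗ₘ
        ε H.functor)) ≫ (α_ _ _ _).hom = (λ_ (𝟙_ B)).inv ≫ (ε F.functor ⊗ₘ
          ((λ_ (𝟙_ B)).inv ≫ (ε G.functor ⊗ₘ ε H.functor)))
      rw [← whiskerRight_comp_tensorHom, ← whiskerLeft_comp_tensorHom, Category.assoc,
        Category.assoc, associator_naturality, unitors_inv_equal,
        triangle_assoc_comp_right_inv_assoc, unitors_inv_equal])
    (fun X Y => by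
      have h := associator_monoidal (F.functor.obj X) (G.functor.obj X) (H.functor.obj X)
        (F.functor.obj Y) (G.functor.obj Y) (H.functor.obj Y)
      rw [tensorFunctor_μ, tensorFunctor_μ, tensorFunctor_μ, tensorFunctor_μ]
      change (tensorμ _ _ _ _ ≫ ((tensorμ _ _ _ _ ≫ (μ F.functor X Y ⊗ₘ μ G.functor X Y)) ⊗ₘ
        μ H.functor X Y)) ≫ (α_ _ _ _).hom = ((α_ _ _ _).hom ⊗ₘ (α_ _ _ _).hom) ≫
          tensorμ _ _ _ _ ≫ (μ F.functor X Y ⊗ₘ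
            (tensorμ _ _ _ _ ≫ (μ G.functor X Y ⊗ₘ μ H.functor X Y)))
      rw [← whiskerRight_comp_tensorHom, ← whiskerLeft_comp_tensorHom, Category.assoc,
        Category.assoc, associator_naturality, reassoc_of% h])

/-- The left unit constraint of the pointwise tensor product. -/
def tensorLeftUnitor (F : StrongFunctor A B) : tensorFunctor (unitFunctor A B) F ≅ F :=
  isoOfComponents (fun X => λ_ (F.functor.obj X))
    (fun f => show (𝟙 (𝟙_ B) ⊗ₘ F.functor.map f) ≫ (λ_ _).hom = (λ_ _).hom ≫ F.functor.map f by
      rw [id_tensorHom, leftUnitor_naturality])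
    (by simp)
    (fun X Y => by
      have h := leftUnitor_monoidal (F.functor.obj X) (F.functor.obj Y)
      rw [tensorFunctor_μ]
      change (tensorμ _ _ _ _ ≫ ((λ_ (𝟙_ B)).hom ⊗ₘ μ F.functor X Y)) ≫ (λ_ _).hom =
        ((λ_ _).hom ⊗ₘ (λ_ _).hom) ≫ μ F.functor X Y
      simp only [h, MonoidalCategory.tensorHom_def (λ_ (𝟙_ B)).hom, Category.assoc,
        leftUnitor_naturality])

/-- The right unit constraint of the pointwise tensor product. -/
def tensorRightUnitor (F : StrongFunctor A B) : tensorFunctor F (unitFunctor A B) ≅ F :=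
  isoOfComponents (fun X => ρ_ (F.functor.obj X))
    (fun f => show (F.functor.map f ⊗ₘ 𝟙 (𝟙_ B)) ≫ (ρ_ _).hom = (ρ_ _).hom ≫ F.functor.map f by
      rw [tensorHom_id, rightUnitor_naturality])
    (by
      rw [tensorFunctor_ε]
      change ((λ_ (𝟙_ B)).inv ≫ (ε F.functor ⊗ₘ 𝟙 (𝟙_ B))) ≫ (ρ_ _).hom = ε F.functor
      rw [tensorHom_id, Category.assoc, rightUnitor_naturality, ← unitors_equal,
        Iso.inv_hom_id_assoc])
    (fun X Y => by
      have h := rightUnitor_monoidal (F.functor.obj X) (F.functor.obj Y)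
      rw [tensorFunctor_μ]
      change (tensorμ _ _ _ _ ≫ (μ F.functor X Y ⊗ₘ (λ_ (𝟙_ B)).hom)) ≫ (ρ_ _).hom =
        ((ρ_ _).hom ⊗ₘ (ρ_ _).hom) ≫ μ F.functor X Y
      simp only [h, MonoidalCategory.tensorHom_def' _ (λ_ (𝟙_ B)).hom, Category.assoc,
        rightUnitor_naturality])

instance : MonoidalCategoryStruct (StrongFunctor A B) where
  tensorObj := tensorFunctor
  tensorHom := tensorTrans
  whiskerLeft F _ _ β := tensorTrans (𝟙 F) β
  whiskerRight α G := tensorTrans α (𝟙 G)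
  tensorUnit := unitFunctor A B
  associator := tensorAssociator
  leftUnitor := tensorLeftUnitor
  rightUnitor := tensorRightUnitor

instance : MonoidalCategory (StrongFunctor A B) :=
  MonoidalCategory.ofTensorHom
    (id_tensorHom_id := fun F G => trans_ext fun X =>
      id_tensorHom_id (F.functor.obj X) (G.functor.obj X))
    (tensorHom_comp_tensorHom := fun α β α' β' => trans_ext fun X =>
      tensorHom_comp_tensorHom (α.natTrans.app X) (β.natTrans.app X)
        (α'.natTrans.app X) (β'.natTrans.app X))
    (associator_naturality := fun α β γ => trans_ext fun X =>
      associator_naturality (α.natTrans.app X) (β.natTrans.app X) (γ.natTrans.app X))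
    (leftUnitor_naturality := fun {F G} α => trans_ext fun X =>
      show (𝟙 (𝟙_ B) ⊗ₘ α.natTrans.app X) ≫ (λ_ (G.functor.obj X)).hom =
        (λ_ (F.functor.obj X)).hom ≫ α.natTrans.app X by
      rw [id_tensorHom, leftUnitor_naturality])
    (rightUnitor_naturality := fun {F G} α => trans_ext fun X =>
      show (α.natTrans.app X ⊗ₘ 𝟙 (𝟙_ B)) ≫ (ρ_ (G.functor.obj X)).hom =
        (ρ_ (F.functor.obj X)).hom ≫ α.natTrans.app X by
      rw [tensorHom_id, rightUnitor_naturality])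
    (pentagon := fun F G H K => trans_ext fun X =>
      show ((α_ (F.functor.obj X) (G.functor.obj X) (H.functor.obj X)).hom ⊗ₘ
          𝟙 (K.functor.obj X)) ≫ (α_ (F.functor.obj X) (G.functor.obj X ⊗ H.functor.obj X)
          (K.functor.obj X)).hom ≫ (𝟙 (F.functor.obj X) ⊗ₘ
            (α_ (G.functor.obj X) (H.functor.obj X) (K.functor.obj X)).hom) =
        (α_ (F.functor.obj X ⊗ G.functor.obj X) (H.functor.obj X) (K.functor.obj X)).hom ≫
          (α_ (F.functor.obj X) (G.functor.obj X) (H.functor.obj X ⊗ K.functor.obj X)).hom by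
      rw [tensorHom_id, id_tensorHom, pentagon])
    (triangle := fun F G => trans_ext fun X =>
      show (α_ (F.functor.obj X) (𝟙_ B) (G.functor.obj X)).hom ≫
          (𝟙 (F.functor.obj X) ⊗ₘ (λ_ (G.functor.obj X)).hom) =
        (ρ_ (F.functor.obj X)).hom ⊗ₘ 𝟙 (G.functor.obj X) by
      rw [tensorHom_id, id_tensorHom, triangle])

end HomMonoidal

section Composition

open Functor.LaxMonoidal

variable {A B D : SymMonCat.{v, u}}

@[simp]
lemma compFunctor_obj (F : StrongFunctor A B) (G : StrongFunctor B D) (X : A) :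
    (compFunctor F G).functor.obj X = G.functor.obj (F.functor.obj X) := rfl

@[simp]
lemma compFunctor_map (F : StrongFunctor A B) (G : StrongFunctor B D) {X Y : A} (f : X ⟶ Y) :
    (compFunctor F G).functor.map f = G.functor.map (F.functor.map f) := rfl

@[simp]
lemma compFunctor_ε (F : StrongFunctor A B) (G : StrongFunctor B D) :
    ε (compFunctor F G).functor = ε G.functor ≫ G.functor.map (ε F.functor) := rfl

@[simp]
lemma compFunctor_μ (F : StrongFunctor A B) (G : StrongFunctor B D) (X Y : A) :
    μ (compFunctor F G).functor X Y =
      μ G.functor _ _ ≫ G.functor.map (μ F.functor X Y) := rfl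

/-- The pointwise tensor product is preserved by composition on the source side. -/
def compTensorIso (H : StrongFunctor A B) (F G : StrongFunctor B D) :
    compFunctor H (tensorFunctor F G) ≅ tensorFunctor (compFunctor H F) (compFunctor H G) :=
  isoOfComponents (fun _ => Iso.refl _) (by simp) (by simp) (by simp)

/-- The constant functor at the unit is preserved by composition on the source side. -/
def compUnitIso (H : StrongFunctor A B) (D : SymMonCat.{v, u}) :
    compFunctor H (unitFunctor B D) ≅ unitFunctor A D :=
  isoOfComponents (fun _ => Iso.refl (𝟙_ D)) (by simp) (by simp) (by simp)

/-- The pointwise tensor product is preserved by composition on the target side. -/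
def tensorCompIso (F G : StrongFunctor A B) (H : StrongFunctor B D) :
    tensorFunctor (compFunctor F H) (compFunctor G H) ≅ compFunctor (tensorFunctor F G) H :=
  isoOfComponents
    (fun X => Functor.Monoidal.μIso H.functor (F.functor.obj X) (G.functor.obj X))
    (by simp)
    (by
      have h : ε H.functor ≫ H.functor.map (λ_ (𝟙_ B)).inv =
          (λ_ (𝟙_ D)).inv ≫ (ε H.functor ⊗ₘ ε H.functor) ≫ μ H.functor (𝟙_ B) (𝟙_ B) := by
        rw [← left_unitality_inv, MonoidalCategory.tensorHom_def', Category.assoc,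
          leftUnitor_inv_naturality_assoc]
      simp [← tensorHom_comp_tensorHom, reassoc_of% h])
    (fun X Y => by
      have h := tensorμ_comp_μ_tensorHom_μ_comp_μ H.functor (F.functor.obj X) (G.functor.obj X)
        (F.functor.obj Y) (G.functor.obj Y)
      simp only [compFunctor_μ, tensorFunctor_μ, Functor.Monoidal.μIso_hom]
      change (tensorμ _ _ _ _ ≫ ((μ H.functor _ _ ≫ H.functor.map (μ F.functor X Y)) ⊗ₘ
          (μ H.functor _ _ ≫ H.functor.map (μ G.functor X Y)))) ≫ μ H.functor _ _ =
        (μ H.functor _ _ ⊗ₘ μ H.functor _ _) ≫ μ H.functor _ _ ≫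
          H.functor.map (tensorμ _ _ _ _ ≫ (μ F.functor X Y ⊗ₘ μ G.functor X Y))
      rw [← tensorHom_comp_tensorHom, Category.assoc, Category.assoc, μ_natural,
        reassoc_of% h, ← Functor.map_comp])

/-- The constant functor at the unit is preserved by composition on the target side. -/
def unitCompIso (A : SymMonCat.{v, u}) (H : StrongFunctor B D) :
    unitFunctor A D ≅ compFunctor (unitFunctor A B) H :=
  isoOfComponents (fun _ => Functor.Monoidal.εIso H.functor) (by simp) (by simp)
    (by simp [MonoidalCategory.tensorHom_def'])

end Composition

section TensorList

variable {M N : Type*} [Category* M] [MonoidalCategory M] [Category* N] [MonoidalCategory N]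

/-- A map between the objects of two monoidal categories that preserves the unit and tensor
products up to isomorphism. No coherence is required of these isomorphisms. -/
structure PreservesTensor (L : M → N) : Prop where
  unit : Nonempty (L (𝟙_ M) ≅ 𝟙_ N)
  tensor : ∀ X Y, Nonempty (L (X ⊗ Y) ≅ L X ⊗ L Y)

variable {J : Type*}

/-- The tensor product of the objects of a family at the indices in a list. -/
def tensorList (G : J → M) : List J → M
  | [] => 𝟙_ M
  | j :: l => G j ⊗ tensorList G l

lemma PreservesTensor.nonempty_iso_tensorList {L : M → N} (hL : PreservesTensor L) (G : J → M)
    (l : List J) : Nonempty (L (tensorList G l) ≅ tensorList (fun j => L (G j)) l) := by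
  induction l with
  | nil => exact hL.unit
  | cons j l ih =>
    obtain ⟨e⟩ := hL.tensor (G j) (tensorList G l)
    obtain ⟨e'⟩ := ih
    exact ⟨e ≪≫ (Iso.refl _ ⊗ᵢ e')⟩

lemma nonempty_tensorList_iso_unit {G : J → M} {l : List J}
    (h : ∀ j ∈ l, Nonempty (G j ≅ 𝟙_ M)) : Nonempty (tensorList G l ≅ 𝟙_ M) := by
  induction l with
  | nil => exact ⟨Iso.refl _⟩
  | cons j l ih =>
    rw [List.forall_mem_cons] at h
    obtain ⟨e⟩ := h.1
    obtain ⟨e'⟩ := ih h.2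
    exact ⟨(e ⊗ᵢ e') ≪≫ λ_ (𝟙_ M)⟩

lemma nonempty_tensorList_iso_of_mem {G : J → M} {l : List J} (hl : l.Nodup) {k : J} (hk : k ∈ l)
    (h : ∀ j, j ≠ k → Nonempty (G j ≅ 𝟙_ M)) : Nonempty (tensorList G l ≅ G k) := by
  induction l with
  | nil => simp at hk
  | cons j l ih =>
    rw [List.nodup_cons] at hl
    by_cases hjk : j = k
    · subst hjk
      obtain ⟨e⟩ := nonempty_tensorList_iso_unit (l := l) fun i hi =>
        h i (ne_of_mem_of_not_mem hi hl.1)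
      exact ⟨(Iso.refl _ ⊗ᵢ e) ≪≫ ρ_ (G j)⟩
    · obtain ⟨e⟩ := h j hjk
      obtain ⟨e'⟩ := ih hl.2 (List.mem_of_ne_of_mem (Ne.symm hjk) hk)
      exact ⟨(e ⊗ᵢ e') ≪≫ λ_ (G k)⟩

lemma nonempty_tensorList_iso_tensorList {G G' : J → M} (h : ∀ j, Nonempty (G j ≅ G' j))
    (l : List J) : Nonempty (tensorList G l ≅ tensorList G' l) := by
  induction l with
  | nil => exact ⟨Iso.refl _⟩
  | cons j l ih =>
    obtain ⟨e⟩ := h j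
    obtain ⟨e_tail⟩ := ih
    exact ⟨e ⊗ᵢ e_tail⟩

/-- The tensor product of a finite family of objects. -/
noncomputable def tensorFamily [Finite J] (G : J → M) : M :=
  tensorList G (@Finset.univ J (Fintype.ofFinite J)).toList

lemma PreservesTensor.nonempty_iso_tensorFamily [Finite J] {L : M → N} (hL : PreservesTensor L)
    (G : J → M) : Nonempty (L (tensorFamily G) ≅ tensorFamily fun j => L (G j)) :=
  hL.nonempty_iso_tensorList G _

lemma nonempty_tensorFamily_iso_tensorFamily [Finite J] {G G' : J → M}
    (h : ∀ j, Nonempty (G j ≅ G' j)) : Nonempty (tensorFamily G ≅ tensorFamily G') :=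
  nonempty_tensorList_iso_tensorList h _

lemma nonempty_tensorFamily_iso [Finite J] {G : J → M} (k : J)
    (h : ∀ j, j ≠ k → Nonempty (G j ≅ 𝟙_ M)) : Nonempty (tensorFamily G ≅ G k) :=
  nonempty_tensorList_iso_of_mem (Finset.nodup_toList _)
    (Finset.mem_toList.2 (@Finset.mem_univ J (Fintype.ofFinite J) k)) h

end TensorList

section Biproduct

open Bicategory

instance (A B : SymMonCat.{v, u}) : MonoidalCategory (A ⟶ B) :=
  inferInstanceAs (MonoidalCategory (StrongFunctor A B))

variable {A B D : SymMonCat.{v, u}}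

lemma preservesTensor_comp (H : B ⟶ D) : PreservesTensor fun F : A ⟶ B => F ≫ H where
  unit := ⟨(unitCompIso A H).symm⟩
  tensor F G := ⟨(tensorCompIso F G H).symm⟩

lemma preservesTensor_comp_precomp {K : Type*} [Category* K] (H : A ⟶ B) :
    PreservesTensor fun P : K ⥤ (B ⟶ D) => P ⋙ precomp D H where
  unit := ⟨NatIso.ofComponents fun _ => compUnitIso H D⟩
  tensor P Q := ⟨NatIso.ofComponents (fun k => compTensorIso H (P.obj k) (Q.obj k)) fun _ =>
    trans_ext fun _ => (Category.comp_id _).trans (Category.id_comp _).symm⟩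

lemma preservesTensor_functorComp {K K' M : Type*} [Category* K] [Category* K'] [Category* M]
    [MonoidalCategory M] (Q : K' ⥤ K) :
    PreservesTensor fun P : K ⥤ M => Q ⋙ P where
  unit := ⟨Iso.refl _⟩
  tensor _ _ := ⟨Iso.refl _⟩

lemma preservesTensor_precomp : PreservesTensor fun H : A ⟶ B => precomp D H where
  unit := ⟨(NatIso.ofComponents (fun H => unitCompIso A H) fun α =>
    trans_ext fun _ => (Category.id_comp _).trans
      (NatTrans.IsMonoidal.unit (τ := MonoidalTrans.natTrans α)).symm).symm⟩
  tensor F G := ⟨(NatIso.ofComponents (fun H => tensorCompIso F G H) fun α => trans_ext fun X =>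
    (NatTrans.IsMonoidal.tensor (τ := α.natTrans) (F.functor.obj X) (G.functor.obj X)).symm).symm⟩

lemma isEquivalence_coneComparison {K : Type*} [Bicategory K] {J : Type*} {A : J → K} {P : K}
    {π : ∀ j, P ⟶ A j} (h : IsStrictTwoProduct π) (X : K) :
    (coneComparison π X).IsEquivalence := by
  obtain ⟨G, h₁, h₂⟩ := h X
  exact (CategoryTheory.Equivalence.mk _ G (eqToIso h₁.symm) (eqToIso h₂)).isEquivalence_functor

variable {J : Type*} [Finite J] {C : J → SymMonCat.{v, u}} {P : SymMonCat.{v, u}}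
  {π : ∀ j, P ⟶ C j} {i : ∀ j, C j ⟶ P}

lemma nonempty_tensorFamily_comp_iso_id (hπ : (coneComparison π P).IsEquivalence)
    (h_self : ∀ j, Nonempty (i j ≫ π j ≅ 𝟙 (C j)))
    (h_ne : ∀ j k, j ≠ k → Nonempty (i j ≫ π k ≅ 𝟙_ (C j ⟶ C k))) :
    Nonempty (tensorFamily (fun j => π j ≫ i j) ≅ 𝟙 P) := by
  have h (k : J) : Nonempty (tensorFamily (fun j => π j ≫ i j) ≫ π k ≅ 𝟙 P ≫ π k) := by
    obtain ⟨e₁⟩ := (preservesTensor_comp (π k)).nonempty_iso_tensorFamily fun j => π j ≫ i j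
    obtain ⟨e₂⟩ := nonempty_tensorFamily_iso (G := fun j => (π j ≫ i j) ≫ π k) k fun j hj =>
      (h_ne j k hj).map fun e => α_ _ _ _ ≪≫ whiskerLeftIso (π j) e ≪≫ compUnitIso (π j) (C k)
    obtain ⟨e₃⟩ := h_self k
    exact ⟨e₁ ≪≫ e₂ ≪≫ α_ _ _ _ ≪≫ whiskerLeftIso (π k) e₃ ≪≫ ρ_ (π k) ≪≫
      (Bicategory.leftUnitor (π k)).symm⟩
  exact ⟨(coneComparison π P).preimageIso (Pi.isoMk fun k => (h k).some)⟩

lemma nonempty_tensorFamily_comp_precomp_iso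
    (h_self : ∀ j, Nonempty (i j ≫ π j ≅ 𝟙 (C j)))
    (h_ne : ∀ j k, j ≠ k → Nonempty (i j ≫ π k ≅ 𝟙_ (C j ⟶ C k)))
    (X : SymMonCat.{v, u}) (k : J) :
    Nonempty (tensorFamily (fun j => Pi.eval (fun j => C j ⟶ X) j ⋙ precomp X (π j)) ⋙
      precomp X (i k) ≅ Pi.eval _ k) := by
  have h (j : J) {f : C k ⟶ C j} (e : i k ≫ π j ≅ f) :
      (Pi.eval (fun j => C j ⟶ X) j ⋙ precomp X (π j)) ⋙ precomp X (i k) ≅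
        Pi.eval _ j ⋙ precomp X f :=
    Functor.isoWhiskerLeft (Pi.eval (fun j => C j ⟶ X) j)
      ((associatorNatIsoRight (i k) (π j) X).symm ≪≫ (precomposing (C k) (C j) X).mapIso e)
  obtain ⟨e₁⟩ := (preservesTensor_comp_precomp (i k)).nonempty_iso_tensorFamily
    fun j => Pi.eval (fun j => C j ⟶ X) j ⋙ precomp X (π j)
  obtain ⟨e₂⟩ := nonempty_tensorFamily_iso
    (G := fun j => (Pi.eval (fun j => C j ⟶ X) j ⋙ precomp X (π j)) ⋙ precomp X (i k)) k
    fun j hj => by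
      obtain ⟨e⟩ := h_ne k j hj.symm
      obtain ⟨e'⟩ := (preservesTensor_precomp (A := C k) (B := C j) (D := X)).unit
      exact ⟨h j e ≪≫ Functor.isoWhiskerLeft (Pi.eval (fun j => C j ⟶ X) j) e'⟩
  obtain ⟨e₃⟩ := h_self k
  exact ⟨e₁ ≪≫ e₂ ≪≫ h k e₃ ≪≫
    Functor.isoWhiskerLeft (Pi.eval (fun j => C j ⟶ X) k) (leftUnitorNatIso (C k) X)⟩

lemma nonempty_coconeComparison_comp_tensorFamily_iso
    (h : Nonempty (tensorFamily (fun j => π j ≫ i j) ≅ 𝟙 P)) (X : SymMonCat.{v, u}) :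
    Nonempty (coconeComparison i X ⋙
      tensorFamily (fun j => Pi.eval (fun j => C j ⟶ X) j ⋙ precomp X (π j)) ≅ 𝟭 (P ⟶ X)) := by
  obtain ⟨e⟩ := h
  obtain ⟨e₁⟩ := (preservesTensor_functorComp (coconeComparison i X)).nonempty_iso_tensorFamily
    fun j => Pi.eval (fun j => C j ⟶ X) j ⋙ precomp X (π j)
  obtain ⟨e₂⟩ := nonempty_tensorFamily_iso_tensorFamily fun j =>
    ⟨show coconeComparison i X ⋙ Pi.eval (fun j => C j ⟶ X) j ⋙ precomp X (π j) ≅ _ from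
      (associatorNatIsoRight (π j) (i j) X).symm⟩
  obtain ⟨e₃⟩ := (preservesTensor_precomp (D := X)).nonempty_iso_tensorFamily fun j => π j ≫ i j
  exact ⟨e₁ ≪≫ e₂ ≪≫ e₃.symm ≪≫ (precomposing P P X).mapIso e ≪≫ leftUnitorNatIso P X⟩

/-- The identity of a finite product is the tensor product of the idempotents `π j ≫ i j`, and a
functor out of it is the tensor product of its restrictions to the factors. -/
theorem isTwoCoproduct_of_biproduct (hπ : (coneComparison π P).IsEquivalence)
    (h_self : ∀ j, Nonempty (i j ≫ π j ≅ 𝟙 (C j)))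
    (h_ne : ∀ j k, j ≠ k → Nonempty (i j ≫ π k ≅ 𝟙_ (C j ⟶ C k))) :
    IsTwoCoproduct i := fun X => by
  obtain ⟨e⟩ := nonempty_coconeComparison_comp_tensorFamily_iso
    (nonempty_tensorFamily_comp_iso_id hπ h_self h_ne) X
  have e' : tensorFamily (fun j => Pi.eval (fun j => C j ⟶ X) j ⋙ precomp X (π j)) ⋙
      coconeComparison i X ≅ 𝟭 (∀ j, C j ⟶ X) :=
    NatIso.pi' fun k => (nonempty_tensorFamily_comp_precomp_iso h_self h_ne X k).some
  exact (CategoryTheory.Equivalence.mk _ _ e.symm e').isEquivalence_functor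

end Biproduct

section Filtration

/-- An exhaustive filtration of a category by subcategories `supp s`, which need not contain all
objects. An object belongs to `supp s` if its identity does. -/
structure Filtration (ι : Type*) [Lattice ι] (S : Type*) [Category* S] where
  supp : ι → MorphismProperty S
  monotone : Monotone supp
  id_source {s : ι} {c d : S} {f : c ⟶ d} (hf : supp s f) : supp s (𝟙 c)
  id_target {s : ι} {c d : S} {f : c ⟶ d} (hf : supp s f) : supp s (𝟙 d)
  inf {s t : ι} {c d : S} {f : c ⟶ d} (hs : supp s f) (ht : supp t f) : supp (s ⊓ t) f
  exhaustive {c d : S} (f : c ⟶ d) : ∃ s, supp s f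

open Functor.LaxMonoidal

variable {ι : Type*} [Lattice ι] {S : SymMonCat.{v, u}} (W : Filtration ι S)

/-- A monoidal natural transformation that is only defined on the subcategory `W.supp s`. -/
@[ext]
structure PartialTrans (s : ι) {X : SymMonCat.{v, u}} (F G : StrongFunctor S X) where
  app (c : S) (hc : W.supp s (𝟙 c)) : F.functor.obj c ⟶ G.functor.obj c
  naturality {c d : S} (f : c ⟶ d) (hf : W.supp s f) :
    F.functor.map f ≫ app d (W.id_target hf) = app c (W.id_source hf) ≫ G.functor.map f
  unit (h : W.supp s (𝟙 (𝟙_ S))) : ε F.functor ≫ app (𝟙_ S) h = ε G.functor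
  tensor (c d : S) (hc : W.supp s (𝟙 c)) (hd : W.supp s (𝟙 d)) (hcd : W.supp s (𝟙 (c ⊗ d))) :
    μ F.functor c d ≫ app (c ⊗ d) hcd = (app c hc ⊗ₘ app d hd) ≫ μ G.functor c d

/-- The type of strong functors `S ⟶ X`, as the objects of the category whose morphisms are the
monoidal transformations defined on `W.supp s`. -/
def StrongFunctorOn (_ : Filtration ι S) (_ : ι) (X : SymMonCat.{v, u}) := StrongFunctor S X

instance (s : ι) (X : SymMonCat.{v, u}) : Category (StrongFunctorOn W s X) where
  Hom F G := PartialTrans W s F G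
  id F :=
    { app c _ := 𝟙 _
      naturality f _ := (Category.comp_id _).trans (Category.id_comp _).symm
      unit _ := Category.comp_id _
      tensor c d _ _ _ := by simp }
  comp {F G H} α β :=
    { app c hc := α.app c hc ≫ β.app c hc
      naturality f hf := by
        rw [← Category.assoc, α.naturality f hf, Category.assoc, β.naturality f hf, Category.assoc]
      unit h := by rw [← Category.assoc, α.unit, β.unit]
      tensor c d hc hd hcd := by
        rw [← Category.assoc, α.tensor c d hc hd, Category.assoc, β.tensor c d hc hd,
          ← Category.assoc, tensorHom_comp_tensorHom] }
  id_comp _ := PartialTrans.ext (funext₂ fun _ _ => Category.id_comp _)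
  comp_id _ := PartialTrans.ext (funext₂ fun _ _ => Category.comp_id _)
  assoc _ _ _ := PartialTrans.ext (funext₂ fun _ _ => Category.assoc _ _ _)

lemma isIso_of_isIso_app {s : ι} {X : SymMonCat.{v, u}} {F G : StrongFunctorOn W s X}
    (α : F ⟶ G) (h : ∀ c hc, IsIso (PartialTrans.app α c hc)) : IsIso α := by
  let β : G ⟶ F :=
    { app c hc := inv (PartialTrans.app α c hc)
      naturality f hf := by
        rw [IsIso.comp_inv_eq, Category.assoc, PartialTrans.naturality α f hf,
          IsIso.inv_hom_id_assoc]
      unit h := by rw [IsIso.comp_inv_eq, PartialTrans.unit α h]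
      tensor c d hc hd hcd := by
        rw [IsIso.comp_inv_eq, Category.assoc, PartialTrans.tensor α c d hc hd hcd,
          ← Category.assoc, tensorHom_comp_tensorHom, IsIso.inv_hom_id, IsIso.inv_hom_id,
          id_tensorHom_id, Category.id_comp] }
  exact ⟨β, PartialTrans.ext (funext₂ fun c hc => IsIso.hom_inv_id _),
    PartialTrans.ext (funext₂ fun c hc => IsIso.inv_hom_id _)⟩

namespace Filtration

variable {W} {X : SymMonCat.{v, u}}

/-- Restriction of transformations to a smaller subcategory. -/
def restrict (W : Filtration ι S) (X : SymMonCat.{v, u}) {s t : ι} (hst : s ≤ t) :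
    StrongFunctorOn W t X ⥤ StrongFunctorOn W s X where
  obj F := F
  map α :=
    { app c hc := α.app c (W.monotone hst _ hc)
      naturality f hf := α.naturality f (W.monotone hst _ hf)
      unit _ := α.unit _
      tensor c d _ _ _ := α.tensor c d _ _ _ }

/-- Restriction of transformations to one of the subcategories. -/
def restrictTotal (W : Filtration ι S) (s : ι) (X : SymMonCat.{v, u}) :
    StrongFunctor S X ⥤ StrongFunctorOn W s X where
  obj F := F
  map α :=
    { app c _ := α.natTrans.app c
      naturality f _ := α.natTrans.naturality f
      unit _ := NatTrans.IsMonoidal.unit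
      tensor c d _ _ _ := NatTrans.IsMonoidal.tensor c d }

/-- A strong functor with values in the subcategory `W.supp s`, including its coherence
morphisms. -/
structure LandsIn {A : SymMonCat.{v, u}} (W : Filtration ι S) (s : ι) (H : StrongFunctor A S) :
    Prop where
  map {a b : A} (f : a ⟶ b) : W.supp s (H.functor.map f)
  unit : W.supp s (ε H.functor)
  tensor (a b : A) : W.supp s (μ H.functor a b)

lemma LandsIn.id_obj {A : SymMonCat.{v, u}} {s : ι} {H : StrongFunctor A S} (hH : W.LandsIn s H)
    (a : A) : W.supp s (𝟙 (H.functor.obj a)) :=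
  W.id_source (hH.map (𝟙 a))

/-- Whiskering on the left by a strong functor that lands in `W.supp s` turns a transformation on
`W.supp s` into a monoidal transformation. -/
def LandsIn.whisker {A : SymMonCat.{v, u}} {s : ι} {H : StrongFunctor A S} (hH : W.LandsIn s H)
    {F G : StrongFunctor S X} (α : PartialTrans W s F G) : compFunctor H F ⟶ compFunctor H G :=
  MonoidalTrans.mk
    { app a := α.app (H.functor.obj a) (hH.id_obj a)
      naturality _ _ f := α.naturality _ (hH.map f) }
    (isMonoidal :=
      { unit := calc
          (ε F.functor ≫ F.functor.map (ε H.functor)) ≫ α.app _ _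
          _ = (ε F.functor ≫ α.app (𝟙_ S) (W.id_source hH.unit)) ≫ G.functor.map (ε H.functor) := by
            rw [Category.assoc, α.naturality _ hH.unit, Category.assoc]
          _ = ε G.functor ≫ G.functor.map (ε H.functor) := by rw [α.unit]
        tensor a b := calc
          (μ F.functor _ _ ≫ F.functor.map (μ H.functor a b)) ≫ α.app _ _
          _ = (μ F.functor _ _ ≫ α.app _ (W.id_source (hH.tensor a b))) ≫
                G.functor.map (μ H.functor a b) := by
            rw [Category.assoc, α.naturality _ (hH.tensor a b), Category.assoc]
          _ = (α.app _ (hH.id_obj a) ⊗ₘ α.app _ (hH.id_obj b)) ≫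
                μ G.functor _ _ ≫ G.functor.map (μ H.functor a b) := by
            rw [α.tensor _ _ (hH.id_obj a) (hH.id_obj b), Category.assoc] })

/-- Precomposition with a strong functor that lands in `W.supp s`. -/
def LandsIn.precomp {A : SymMonCat.{v, u}} {s : ι} {H : StrongFunctor A S} (hH : W.LandsIn s H)
    (X : SymMonCat.{v, u}) : StrongFunctorOn W s X ⥤ StrongFunctor A X where
  obj F := compFunctor H F
  map α := hH.whisker α

end Filtration
end Filtration

section Gluing

open Filter Functor.LaxMonoidal

variable {ι : Type*} [Lattice ι] {S X : SymMonCat.{v, u}} {W : Filtration ι S}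

namespace Filtration

lemma eventually_supp (W : Filtration ι S) {c d : S} (f : c ⟶ d) : ∀ᶠ t in atTop, W.supp t f := by
  obtain ⟨s, hs⟩ := W.exhaustive f
  exact (eventually_ge_atTop s).mono fun t hst => W.monotone hst f hs

lemma exists_of_eventually (W : Filtration ι S) {p : ι → Prop} (h : ∀ᶠ t in atTop, p t) :
    ∃ t, p t :=
  have : Nonempty ι := ⟨(W.exhaustive (𝟙 (𝟙_ S))).choose⟩
  h.exists

lemma exists_supp_tensor (W : Filtration ι S) (c d : S) :
    ∃ s, W.supp s (𝟙 c) ∧ W.supp s (𝟙 d) ∧ W.supp s (𝟙 (c ⊗ d)) :=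
  W.exists_of_eventually <| (W.eventually_supp (𝟙 c)).and <|
    (W.eventually_supp (𝟙 d)).and <| W.eventually_supp (𝟙 (c ⊗ d))

lemma exists_glued_trans {F G : StrongFunctor S X} (α : ∀ s, PartialTrans W s F G)
    (h : ∀ s t c hs ht, (α s).app c hs = (α t).app c ht) :
    ∃ β : F ⟶ G, ∀ s, (W.restrictTotal s X).map β = α s := by
  choose σ hσ using fun c : S => W.exhaustive (𝟙 c)
  have app_eq (s c hs) : (α (σ c)).app c (hσ c) = (α s).app c hs := h _ _ _ _ _
  refine ⟨MonoidalTrans.mk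
    { app c := (α (σ c)).app c (hσ c)
      naturality c d f := ?_ } (isMonoidal := { unit := ?_, tensor := fun c d => ?_ }),
    fun s => PartialTrans.ext (funext₂ fun c hc => app_eq s c hc)⟩
  · obtain ⟨s, hf⟩ := W.exhaustive f
    rw [app_eq s c (W.id_source hf), app_eq s d (W.id_target hf)]
    exact (α s).naturality f hf
  · exact (α _).unit _
  · obtain ⟨s, hc, hd, hcd⟩ := W.exists_supp_tensor c d
    dsimp only
    rw [app_eq s c hc, app_eq s d hd, app_eq s _ hcd]
    exact (α s).tensor c d hc hd hcd

end Filtration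

/-- Gluing data for a strong functor on a filtered category: a strong functor for each stage of the
filtration, and transition transformations on the intersections that satisfy the cocycle
condition. -/
structure GluingData (W : Filtration ι S) (X : SymMonCat.{v, u}) where
  functor : ι → StrongFunctor S X
  trans (s t : ι) : PartialTrans W (s ⊓ t) (functor s) (functor t)
  trans_self {s : ι} {c : S} (hs : W.supp s (𝟙 c)) : (trans s s).app c (W.inf hs hs) = 𝟙 _
  trans_trans {r s t : ι} {c : S} (hr : W.supp r (𝟙 c)) (hs : W.supp s (𝟙 c))
    (ht : W.supp t (𝟙 c)) :
    (trans r s).app c (W.inf hr hs) ≫ (trans s t).app c (W.inf hs ht) =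
      (trans r t).app c (W.inf hr ht)

namespace GluingData

variable (T : GluingData W X)

/-- The transition isomorphism at an object of the intersection of two stages. -/
def transIso {s t : ι} {c : S} (hs : W.supp s (𝟙 c)) (ht : W.supp t (𝟙 c)) :
    (T.functor s).functor.obj c ≅ (T.functor t).functor.obj c where
  hom := (T.trans s t).app c (W.inf hs ht)
  inv := (T.trans t s).app c (W.inf ht hs)
  hom_inv_id := (T.trans_trans hs ht hs).trans (T.trans_self hs)
  inv_hom_id := (T.trans_trans ht hs ht).trans (T.trans_self ht)

/-- The value of the glued functor is the value of the functor of an arbitrary stage containing the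
object. -/
noncomputable def glueObj (c : S) : X :=
  (T.functor (W.exhaustive (𝟙 c)).choose).functor.obj c

/-- The identification of the glued functor with the functor of any stage containing the object. -/
noncomputable def chart {t : ι} {c : S} (ht : W.supp t (𝟙 c)) :
    T.glueObj c ≅ (T.functor t).functor.obj c :=
  T.transIso (W.exhaustive (𝟙 c)).choose_spec ht

lemma chart_trans {s t : ι} {c : S} (hs : W.supp s (𝟙 c)) (ht : W.supp t (𝟙 c)) :
    (T.chart hs).hom ≫ (T.trans s t).app c (W.inf hs ht) = (T.chart ht).hom :=
  T.trans_trans (W.exhaustive (𝟙 c)).choose_spec hs ht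

lemma trans_chart_inv {s t : ι} {c : S} (hs : W.supp s (𝟙 c)) (ht : W.supp t (𝟙 c)) :
    (T.trans s t).app c (W.inf hs ht) ≫ (T.chart ht).inv = (T.chart hs).inv := by
  rw [Iso.comp_inv_eq, ← T.chart_trans hs ht, Iso.inv_hom_id_assoc]

/-- The action of the glued functor on morphisms, computed in an arbitrary stage. -/
noncomputable def glueMap {c d : S} (f : c ⟶ d) : T.glueObj c ⟶ T.glueObj d :=
  have hf := (W.exhaustive f).choose_spec
  (T.chart (W.id_source hf)).hom ≫ (T.functor _).functor.map f ≫ (T.chart (W.id_target hf)).inv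

lemma glueMap_eq {t : ι} {c d : S} {f : c ⟶ d} (hf : W.supp t f) :
    T.glueMap f = (T.chart (W.id_source hf)).hom ≫ (T.functor t).functor.map f ≫
      (T.chart (W.id_target hf)).inv := by
  have hs := (W.exhaustive f).choose_spec
  rw [← T.chart_trans (W.id_source hs) (W.id_source hf), Category.assoc,
    ← reassoc_of% (T.trans _ t).naturality f (W.inf hs hf),
    T.trans_chart_inv (W.id_target hs) (W.id_target hf)]
  rfl

lemma glueMap_chart {t : ι} {c d : S} {f : c ⟶ d} (hf : W.supp t f) :
    T.glueMap f ≫ (T.chart (W.id_target hf)).hom =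
      (T.chart (W.id_source hf)).hom ≫ (T.functor t).functor.map f := by
  rw [T.glueMap_eq hf, Category.assoc, Category.assoc, Iso.inv_hom_id, Category.comp_id]

/-- The unit coherence isomorphism of the glued functor, computed in an arbitrary stage. -/
noncomputable def glueε : 𝟙_ X ≅ T.glueObj (𝟙_ S) :=
  Functor.Monoidal.εIso (T.functor _).functor ≪≫
    (T.chart (W.exhaustive (𝟙 (𝟙_ S))).choose_spec).symm

lemma glueε_chart {t : ι} (h : W.supp t (𝟙 (𝟙_ S))) :
    T.glueε.hom ≫ (T.chart h).hom = ε (T.functor t).functor := by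
  have hs := (W.exhaustive (𝟙 (𝟙_ S))).choose_spec
  rw [← T.chart_trans hs h, ← (T.trans _ t).unit (W.inf hs h)]
  simp [glueε]

/-- The tensor coherence isomorphisms of the glued functor, computed in an arbitrary stage. -/
noncomputable def glueμ (c d : S) : T.glueObj c ⊗ T.glueObj d ≅ T.glueObj (c ⊗ d) :=
  have h := (W.exists_supp_tensor c d).choose_spec
  (T.chart h.1 ⊗ᵢ T.chart h.2.1) ≪≫ Functor.Monoidal.μIso (T.functor _).functor c d ≪≫
    (T.chart h.2.2).symm

lemma glueμ_chart {t : ι} {c d : S} (hc : W.supp t (𝟙 c)) (hd : W.supp t (𝟙 d))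
    (hcd : W.supp t (𝟙 (c ⊗ d))) :
    (T.glueμ c d).hom ≫ (T.chart hcd).hom =
      ((T.chart hc).hom ⊗ₘ (T.chart hd).hom) ≫ μ (T.functor t).functor c d := by
  have h := (W.exists_supp_tensor c d).choose_spec
  rw [← T.chart_trans h.2.2 hcd, ← T.chart_trans h.1 hc, ← T.chart_trans h.2.1 hd,
    ← tensorHom_comp_tensorHom, Category.assoc,
    ← (T.trans _ t).tensor c d (W.inf h.1 hc) (W.inf h.2.1 hd) (W.inf h.2.2 hcd)]
  simp [glueμ]

end GluingData
end Gluing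

namespace GluingData

open Functor.LaxMonoidal

variable {ι : Type*} [Lattice ι] {S X : SymMonCat.{v, u}} {W : Filtration ι S}
  (T : GluingData W X)

/-- The underlying functor of the glued functor. -/
noncomputable def glueFunctor : S ⥤ X where
  obj := T.glueObj
  map := T.glueMap
  map_id c := by
    obtain ⟨t, ht⟩ := W.exhaustive (𝟙 c)
    rw [T.glueMap_eq ht, CategoryTheory.Functor.map_id, Category.id_comp, Iso.hom_inv_id]
  map_comp f g := by
    obtain ⟨t, hf, hg, hfg⟩ := W.exists_of_eventually <| (W.eventually_supp f).and <|
      (W.eventually_supp g).and <| W.eventually_supp (f ≫ g)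
    rw [T.glueMap_eq hf, T.glueMap_eq hg, T.glueMap_eq hfg]
    simp

lemma glueMap_whiskerRight {c d : S} (f : c ⟶ d) (e : S) :
    T.glueMap f ▷ T.glueObj e ≫ (T.glueμ d e).hom = (T.glueμ c e).hom ≫ T.glueMap (f ▷ e) := by
  obtain ⟨t, hf, he, hfe⟩ := W.exists_of_eventually <| (W.eventually_supp f).and <|
    (W.eventually_supp (𝟙 e)).and <| W.eventually_supp (f ▷ e)
  rw [← cancel_mono (T.chart (W.id_target hfe)).hom, Category.assoc, Category.assoc,
    T.glueμ_chart (W.id_target hf) he, T.glueMap_chart hfe,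
    reassoc_of% T.glueμ_chart (W.id_source hf) he (W.id_source hfe), ← μ_natural_left,
    ← Category.assoc, ← Category.assoc, ← tensorHom_id, ← tensorHom_id, tensorHom_comp_tensorHom,
    tensorHom_comp_tensorHom, T.glueMap_chart hf, Category.id_comp, Category.comp_id]

lemma glueMap_whiskerLeft (e : S) {c d : S} (f : c ⟶ d) :
    T.glueObj e ◁ T.glueMap f ≫ (T.glueμ e d).hom = (T.glueμ e c).hom ≫ T.glueMap (e ◁ f) := by
  obtain ⟨t, hf, he, hef⟩ := W.exists_of_eventually <| (W.eventually_supp f).and <|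
    (W.eventually_supp (𝟙 e)).and <| W.eventually_supp (e ◁ f)
  rw [← cancel_mono (T.chart (W.id_target hef)).hom, Category.assoc, Category.assoc,
    T.glueμ_chart he (W.id_target hf), T.glueMap_chart hef,
    reassoc_of% T.glueμ_chart he (W.id_source hf) (W.id_source hef), ← μ_natural_right,
    ← Category.assoc, ← Category.assoc, ← id_tensorHom, ← id_tensorHom, tensorHom_comp_tensorHom,
    tensorHom_comp_tensorHom, T.glueMap_chart hf, Category.id_comp, Category.comp_id]

lemma glueμ_associativity (c d e : S) :
    (T.glueμ c d).hom ▷ T.glueObj e ≫ (T.glueμ (c ⊗ d) e).hom ≫ T.glueMap (α_ c d e).hom =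
      (α_ (T.glueObj c) (T.glueObj d) (T.glueObj e)).hom ≫
        T.glueObj c ◁ (T.glueμ d e).hom ≫ (T.glueμ c (d ⊗ e)).hom := by
  obtain ⟨t, hc, hd, he, hcd, hde, hα⟩ := W.exists_of_eventually <|
    (W.eventually_supp (𝟙 c)).and <| (W.eventually_supp (𝟙 d)).and <|
    (W.eventually_supp (𝟙 e)).and <| (W.eventually_supp (𝟙 (c ⊗ d))).and <|
    (W.eventually_supp (𝟙 (d ⊗ e))).and <| W.eventually_supp (α_ c d e).hom
  have h_left : (T.glueμ c d).hom ▷ T.glueObj e ≫ ((T.chart hcd).hom ⊗ₘ (T.chart he).hom) =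
      (((T.chart hc).hom ⊗ₘ (T.chart hd).hom) ⊗ₘ (T.chart he).hom) ≫
        μ (T.functor t).functor c d ▷ _ := by
    rw [whiskerRight_comp_tensorHom, T.glueμ_chart hc hd, tensorHom_comp_whiskerRight]
  have h_right : T.glueObj c ◁ (T.glueμ d e).hom ≫ ((T.chart hc).hom ⊗ₘ (T.chart hde).hom) =
      ((T.chart hc).hom ⊗ₘ ((T.chart hd).hom ⊗ₘ (T.chart he).hom)) ≫
        _ ◁ μ (T.functor t).functor d e := by
    rw [whiskerLeft_comp_tensorHom, T.glueμ_chart hd he, tensorHom_comp_whiskerLeft]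
  rw [← cancel_mono (T.chart (W.id_target hα)).hom]
  simp only [Category.assoc]
  rw [T.glueMap_chart hα, reassoc_of% T.glueμ_chart hcd he (W.id_source hα),
    T.glueμ_chart hc hde, reassoc_of% h_left, reassoc_of% h_right, associativity,
    associator_naturality_assoc]

lemma glue_left_unitality (c : S) :
    (λ_ (T.glueObj c)).hom =
      T.glueε.hom ▷ T.glueObj c ≫ (T.glueμ (𝟙_ S) c).hom ≫ T.glueMap (λ_ c).hom := by
  obtain ⟨t, hu, hl⟩ := W.exists_of_eventually <|
    (W.eventually_supp (𝟙 (𝟙_ S))).and <| W.eventually_supp (λ_ c).hom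
  have hc := W.id_target hl
  rw [← cancel_mono (T.chart hc).hom]
  simp only [Category.assoc]
  rw [T.glueMap_chart hl, reassoc_of% T.glueμ_chart hu hc (W.id_source hl),
    whiskerRight_comp_tensorHom_assoc, T.glueε_chart hu, ← leftUnitor_naturality,
    left_unitality, tensorHom_def', Category.assoc]

lemma glue_right_unitality (c : S) :
    (ρ_ (T.glueObj c)).hom =
      T.glueObj c ◁ T.glueε.hom ≫ (T.glueμ c (𝟙_ S)).hom ≫ T.glueMap (ρ_ c).hom := by
  obtain ⟨t, hu, hl⟩ := W.exists_of_eventually <|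
    (W.eventually_supp (𝟙 (𝟙_ S))).and <| W.eventually_supp (ρ_ c).hom
  have hc := W.id_target hl
  rw [← cancel_mono (T.chart hc).hom]
  simp only [Category.assoc]
  rw [T.glueMap_chart hl, reassoc_of% T.glueμ_chart hc hu (W.id_source hl),
    whiskerLeft_comp_tensorHom_assoc, T.glueε_chart hu, ← rightUnitor_naturality, right_unitality,
    MonoidalCategory.tensorHom_def, Category.assoc]

lemma glueμ_braiding (c d : S) :
    (T.glueμ c d).hom ≫ T.glueMap (β_ c d).hom =
      (β_ (T.glueObj c) (T.glueObj d)).hom ≫ (T.glueμ d c).hom := by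
  obtain ⟨t, hc, hd, hβ⟩ := W.exists_of_eventually <| (W.eventually_supp (𝟙 c)).and <|
    (W.eventually_supp (𝟙 d)).and <| W.eventually_supp (β_ c d).hom
  rw [← cancel_mono (T.chart (W.id_target hβ)).hom, Category.assoc, Category.assoc,
    T.glueMap_chart hβ, reassoc_of% T.glueμ_chart hc hd (W.id_source hβ),
    T.glueμ_chart hd hc, Functor.LaxBraided.braided, ← BraidedCategory.braiding_naturality_assoc]

/-- The strong functor glued from gluing data. -/
noncomputable def glue : StrongFunctor S X where
  functor := T.glueFunctor
  braided :=
    { toMonoidal := Functor.CoreMonoidal.toMonoidal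
        { εIso := T.glueε
          μIso := T.glueμ
          μIso_hom_natural_left := T.glueMap_whiskerRight
          μIso_hom_natural_right := fun e f => T.glueMap_whiskerLeft e f
          associativity := T.glueμ_associativity
          left_unitality := T.glue_left_unitality
          right_unitality := T.glue_right_unitality }
      braided := T.glueμ_braiding }

/-- The charts, as a transformation on the stage `t`. -/
noncomputable def glueTrans (t : ι) : PartialTrans W t T.glue (T.functor t) where
  app _ hc := (T.chart hc).hom
  naturality _ hf := T.glueMap_chart hf
  unit h := T.glueε_chart h
  tensor _ _ hc hd hcd := T.glueμ_chart hc hd hcd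

lemma nonempty_restrictTotal_glue_iso (t : ι) : Nonempty
    ((W.restrictTotal t X).obj T.glue ≅ (W.restrictTotal t X).obj (T.functor t)) :=
  let α : (W.restrictTotal t X).obj T.glue ⟶ (W.restrictTotal t X).obj (T.functor t) :=
    T.glueTrans t
  have : IsIso α := isIso_of_isIso_app _ α fun _ hc => (T.chart hc).isIso_hom
  ⟨asIso α⟩

end GluingData

section Stages

variable {J : Type*} [DecidableEq J] {A : J → SymMonCat.{v, u}} {S X : SymMonCat.{v, u}}
  {W : Filtration (Finset J) S} {i : ∀ j, A j ⟶ S}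

lemma Filtration.LandsIn.mono {ι : Type*} [Lattice ι] {A : SymMonCat.{v, u}} {W : Filtration ι S}
    {s t : ι} {H : StrongFunctor A S} (hH : W.LandsIn s H) (hst : s ≤ t) : W.LandsIn t H where
  map f := W.monotone hst _ (hH.map f)
  unit := W.monotone hst _ hH.unit
  tensor a b := W.monotone hst _ (hH.tensor a b)

/-- The comparison functor of the universal property of the coproduct, on the stage of a filtration
that contains the images of `i j` for `j ∈ s`. -/
def stageComparison (hi : ∀ j, W.LandsIn {j} (i j)) (s : Finset J) (X : SymMonCat.{v, u}) :
    StrongFunctorOn W s X ⥤ ∀ j : s, A j ⟶ X :=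
  Functor.pi' fun j => ((hi j).mono (Finset.singleton_subset_iff.2 j.2)).precomp X

lemma stageComparison_map_restrictTotal (hi : ∀ j, W.LandsIn {j} (i j)) (s : Finset J)
    {F G : S ⟶ X} (α : F ⟶ G) (j : s) :
    (stageComparison hi s X).map ((W.restrictTotal s X).map α) j =
      (coconeComparison i X).map α j := rfl

variable (hi : ∀ j, W.LandsIn {j} (i j))
  (hs : ∀ s, (stageComparison hi s X).IsEquivalence)
include hs

lemma faithful_coconeComparison : (coconeComparison i X).Faithful where
  map_injective {F G α β} h := trans_ext fun c => by
    obtain ⟨s, hc⟩ := W.exhaustive (𝟙 c)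
    have h_res : (W.restrictTotal s X).map α = (W.restrictTotal s X).map β :=
      (stageComparison hi s X).map_injective (funext fun j => congrFun h j)
    exact congrArg (fun γ => PartialTrans.app γ c hc) h_res

lemma full_coconeComparison : (coconeComparison i X).Full where
  map_surjective {F G} φ := by
    choose α hα using fun s => (stageComparison hi s X).map_surjective
      (X := (W.restrictTotal s X).obj F) (Y := (W.restrictTotal s X).obj G) fun j => φ j
    have compat (s t) : (W.restrict X inf_le_left).map (α s) =
        (W.restrict X (inf_le_right (a := s))).map (α t) :=
      (stageComparison hi (s ⊓ t) X).map_injective <| funext fun j =>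
        (congrFun (hα s) ⟨j, inf_le_left (b := t) j.2⟩).trans
          (congrFun (hα t) ⟨j, inf_le_right (a := s) j.2⟩).symm
    obtain ⟨β, hβ⟩ := Filtration.exists_glued_trans α fun s t c hs ht =>
      congrArg (fun γ => PartialTrans.app γ c (W.inf hs ht)) (compat s t)
    refine ⟨β, funext fun j => ?_⟩
    rw [← stageComparison_map_restrictTotal hi {j} β ⟨j, Finset.mem_singleton_self j⟩, hβ, hα]

/-- A strong functor whose restrictions along `i j` for `j ∈ s` are the given ones. -/
noncomputable def stageLift (F : ∀ j, A j ⟶ X) (s : Finset J) : StrongFunctor S X :=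
  (stageComparison hi s X).objPreimage fun j => F j

/-- The isomorphism that characterizes `stageLift`. -/
noncomputable def stageLiftIso (F : ∀ j, A j ⟶ X) {s : Finset J} {j : J} (hj : j ∈ s) :
    i j ≫ stageLift hi hs F s ≅ F j :=
  Pi.isoApp ((stageComparison hi s X).objObjPreimageIso fun j => F j) ⟨j, hj⟩

/-- The transition transformation between the lifts to two stages. -/
noncomputable def stageTrans (F : ∀ j, A j ⟶ X) (s t : Finset J) :
    PartialTrans W (s ⊓ t) (stageLift hi hs F s) (stageLift hi hs F t) :=
  (stageComparison hi (s ⊓ t) X).preimage fun j =>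
    (stageLiftIso hi hs F (inf_le_left (b := t) j.2)).hom ≫
      (stageLiftIso hi hs F (inf_le_right (a := s) j.2)).inv

lemma whisker_stageTrans (F : ∀ j, A j ⟶ X) {s t : Finset J} {j : J} (h : j ∈ s ⊓ t) :
    ((hi j).mono (Finset.singleton_subset_iff.2 h)).whisker (stageTrans hi hs F s t) =
      (stageLiftIso hi hs F (inf_le_left (b := t) h)).hom ≫
        (stageLiftIso hi hs F (inf_le_right (a := s) h)).inv :=
  congrFun ((stageComparison hi (s ⊓ t) X).map_preimage _) ⟨j, h⟩

/-- The lifts to the stages of the filtration glue: uniqueness of the transition transformations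
gives the cocycle condition. -/
noncomputable def stageGluingData (F : ∀ j, A j ⟶ X) : GluingData W X where
  functor s := stageLift hi hs F s
  trans s t := stageTrans hi hs F s t
  trans_self {s c} hc := by
    have h : stageTrans hi hs F s s = 𝟙 ((W.restrictTotal (s ⊓ s) X).obj (stageLift hi hs F s)) :=
      (stageComparison hi (s ⊓ s) X).map_injective (funext fun j =>
        (whisker_stageTrans hi hs F j.2).trans (Iso.hom_inv_id _))
    exact congrArg (fun γ => PartialTrans.app γ c (W.inf hc hc)) h
  trans_trans {r s t c} hr hs' ht := by
    have hrs : r ⊓ s ⊓ t ≤ r ⊓ s := inf_le_left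
    have hst : r ⊓ s ⊓ t ≤ s ⊓ t := inf_le_inf_right t inf_le_right
    have hrt : r ⊓ s ⊓ t ≤ r ⊓ t := inf_le_inf_right t inf_le_left
    have h : (W.restrict X hrs).map (stageTrans hi hs F r s) ≫
        (W.restrict X hst).map (stageTrans hi hs F s t) =
          (W.restrict X hrt).map (stageTrans hi hs F r t) :=
      (stageComparison hi (r ⊓ s ⊓ t) X).map_injective <| funext fun j =>
        (congrArg₂ (· ≫ ·) (whisker_stageTrans hi hs F (hrs j.2))
          (whisker_stageTrans hi hs F (hst j.2))).trans <|
            ((Category.assoc _ _ _).trans (congrArg _ (Iso.inv_hom_id_assoc _ _))).trans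
              (whisker_stageTrans hi hs F (hrt j.2)).symm
    exact congrArg (fun γ => PartialTrans.app γ c (W.inf (W.inf hr hs') ht)) h

lemma essSurj_coconeComparison : (coconeComparison i X).EssSurj where
  mem_essImage F := by
    let T := stageGluingData hi hs F
    refine ⟨T.glue, ⟨Pi.isoMk fun j => ?_⟩⟩
    have e := (T.nonempty_restrictTotal_glue_iso {j}).some
    exact Pi.isoApp ((stageComparison hi {j} X).mapIso e) ⟨j, Finset.mem_singleton_self j⟩ ≪≫
      stageLiftIso hi hs F (Finset.mem_singleton_self j)

theorem isEquivalence_coconeComparison : (coconeComparison i X).IsEquivalence where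
  faithful := faithful_coconeComparison hi hs
  full := full_coconeComparison hi hs
  essSurj := essSurj_coconeComparison hi hs

end Stages

section StageEquivalence

open Functor.LaxMonoidal

variable {ι : Type*} [Lattice ι] {S P X : SymMonCat.{v, u}} {W : Filtration ι S} {s : ι}

/-- An equivalence between the subcategory `W.supp s` and a symmetric monoidal category `P`, whose
functor `res` to `P` is defined on all of `S`. -/
structure StageEquivalence (W : Filtration ι S) (s : ι) (P : SymMonCat.{v, u}) where
  res : StrongFunctor S P
  ext : StrongFunctor P S
  landsIn_ext : W.LandsIn s ext
  counit : PartialTrans W s (compFunctor res ext) (idFunctor S)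
  supp_counit (c : S) (hc : W.supp s (𝟙 c)) : W.supp s (counit.app c hc)
  isIso_counit (c : S) (hc : W.supp s (𝟙 c)) : IsIso (counit.app c hc)
  ext_comp_res : compFunctor ext res = idFunctor P

namespace StageEquivalence

variable (e : StageEquivalence W s P)

/-- Precomposition with `res`. -/
def precompRes (X : SymMonCat.{v, u}) : (P ⟶ X) ⥤ StrongFunctorOn W s X :=
  Bicategory.precomp X (show S ⟶ P from e.res) ⋙ W.restrictTotal s X

/-- Whiskering of the counit by a strong functor on the right. -/
def counitWhisker (F : StrongFunctor S X) :
    PartialTrans W s (compFunctor e.res (compFunctor e.ext F)) F where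
  app c hc := F.functor.map (e.counit.app c hc)
  naturality f hf :=
    (F.functor.map_comp _ _).symm.trans <|
      (congrArg F.functor.map (e.counit.naturality f hf)).trans (F.functor.map_comp _ _)
  unit h := by
    let κ : e.ext.functor.obj (e.res.functor.obj (𝟙_ S)) ⟶ 𝟙_ S := e.counit.app _ h
    have counit_unit : (ε e.ext.functor ≫ e.ext.functor.map (ε e.res.functor)) ≫ κ = 𝟙 (𝟙_ S) :=
      e.counit.unit h
    calc
      ((ε F.functor ≫ F.functor.map (ε e.ext.functor)) ≫
          F.functor.map (e.ext.functor.map (ε e.res.functor))) ≫ F.functor.map κ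
      _ = ε F.functor ≫ F.functor.map ((ε e.ext.functor ≫ e.ext.functor.map (ε e.res.functor)) ≫
            κ) := by simp only [CategoryTheory.Functor.map_comp, Category.assoc]
      _ = ε F.functor := by rw [counit_unit, CategoryTheory.Functor.map_id, Category.comp_id]
  tensor c d hc hd hcd := by
    let κ (c : S) (hc : W.supp s (𝟙 c)) : e.ext.functor.obj (e.res.functor.obj c) ⟶ c :=
      e.counit.app c hc
    have counit_tensor : (μ e.ext.functor _ _ ≫ e.ext.functor.map (μ e.res.functor c d)) ≫
        κ (c ⊗ d) hcd = κ c hc ⊗ₘ κ d hd :=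
      (e.counit.tensor c d hc hd hcd).trans (Category.comp_id _)
    calc
      ((μ F.functor _ _ ≫ F.functor.map (μ e.ext.functor _ _)) ≫
          F.functor.map (e.ext.functor.map (μ e.res.functor c d))) ≫
            F.functor.map (κ (c ⊗ d) hcd)
      _ = μ F.functor _ _ ≫ F.functor.map ((μ e.ext.functor _ _ ≫
            e.ext.functor.map (μ e.res.functor c d)) ≫ κ (c ⊗ d) hcd) := by
        simp only [CategoryTheory.Functor.map_comp, Category.assoc]
      _ = (F.functor.map (κ c hc) ⊗ₘ F.functor.map (κ d hd)) ≫ μ F.functor c d := by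
        rw [counit_tensor, μ_natural]

/-- The isomorphism `res ≫ ext ≫ F ≅ F` on `W.supp s`, natural in `F`. -/
noncomputable def precompCounitIso (X : SymMonCat.{v, u}) :
    e.landsIn_ext.precomp X ⋙ e.precompRes X ≅ 𝟭 (StrongFunctorOn W s X) :=
  NatIso.ofComponents
    (fun F =>
      have : IsIso (X := (e.landsIn_ext.precomp X ⋙ e.precompRes X).obj F) (Y := F)
          (e.counitWhisker F) := isIso_of_isIso_app _ _ fun c hc =>
        have := e.isIso_counit c hc
        inferInstanceAs (IsIso ((F : StrongFunctor S X).functor.map (e.counit.app c hc)))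
      asIso (e.counitWhisker F))
    fun α => PartialTrans.ext <| funext₂ fun c hc =>
      (PartialTrans.naturality α _ (e.supp_counit c hc)).symm

/-- Strong functors on `W.supp s` are equivalent to strong functors on `P`. -/
noncomputable def precompEquivalence (X : SymMonCat.{v, u}) :
    (P ⟶ X) ≌ StrongFunctorOn W s X :=
  .mk (e.precompRes X) (e.landsIn_ext.precomp X)
    ((Bicategory.leftUnitorNatIso P X).symm ≪≫
      (Bicategory.precomposing P P X).mapIso (eqToIso e.ext_comp_res.symm) ≪≫
        Bicategory.associatorNatIsoRight (show P ⟶ S from e.ext) e.res X)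
    (e.precompCounitIso X)

variable {J : Type*} [DecidableEq J] {A : J → SymMonCat.{v, u}} {V : Filtration (Finset J) S}
  {i : ∀ j, A j ⟶ S} {t : Finset J}

lemma isEquivalence_stageComparison (e : StageEquivalence V t P)
    (hi : ∀ j, V.LandsIn {j} (i j)) (h : IsTwoCoproduct fun j : t => i j ≫ e.res) :
    (stageComparison hi t X).IsEquivalence := by
  have := h X
  have comparison : coconeComparison (fun j : t => i j ≫ (show S ⟶ P from e.res)) X ≅
      (e.precompEquivalence X).functor ⋙ stageComparison hi t X :=
    NatIso.pi' fun j => Bicategory.associatorNatIsoRight (i j) (show S ⟶ P from e.res) X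
  have := Functor.isEquivalence_of_iso comparison
  exact Functor.isEquivalence_of_comp_left (e.precompEquivalence X).functor _

end StageEquivalence

end StageEquivalence

section Coprod

open Functor.LaxMonoidal

lemma IsUnitId.ext {A : Type u} [Category.{v} A] [MonoidalCategory A] {X Y : A} {f g : X ⟶ Y}
    (hf : IsUnitId f) (hg : IsUnitId g) : f = g := by
  obtain ⟨_, _, rfl⟩ := hf
  obtain ⟨_, _, rfl⟩ := hg
  rfl

lemma CoprodObj.eqToHom_app {J : Type w} {C : J → SymMonCat.{v, u}} {c d : CoprodObj C}
    (h : c = d) (j : J) :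
    CoprodObj.Hom.app (eqToHom h) j = eqToHom (congrArg (fun c => CoprodObj.obj c j) h) := by
  subst h
  rfl

variable {J : Type w} {C : J → SymMonCat.{max w v, max w u}} {A : SymMonCat.{max w v, max w u}}

/-- The inclusion of the coproduct in the product, as a strong functor. -/
noncomputable def toProd (C : J → SymMonCat.{v, u}) : coprod C ⟶ prod C :=
  StrongFunctor.mk (C := coprod C) (D := prod C) (CoprodObj.toPi C)
    (braided :=
      { toMonoidal := Monoidal.fromInducedMonoidal (CoprodObj.toPi C) (CoprodObj.toPiData C)
        braided c d := funext fun j =>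
          show (unitTensorIso (CoprodObj.obj c j) (CoprodObj.obj d j)).hom ≫
              (unitBraiding (CoprodObj.obj c j) (CoprodObj.obj d j)).hom =
            (β_ (CoprodObj.obj c j) (CoprodObj.obj d j)).hom ≫
              (unitTensorIso (CoprodObj.obj d j) (CoprodObj.obj c j)).hom by
            simp [unitBraiding] })

/-- The projections from the coproduct. -/
noncomputable def coprodProj (C : J → SymMonCat.{max w v, max w u}) (j : J) : coprod C ⟶ C j :=
  toProd C ≫ proj C j

lemma coprodProj_ε (j : J) : ε (coprodProj C j).functor = 𝟙 (𝟙_ (C j)) :=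
  Category.id_comp (𝟙 (𝟙_ (C j)))

lemma coprodProj_μ (j : J) (c d : coprod C) :
    μ (coprodProj C j).functor c d =
      (unitTensorIso (CoprodObj.obj c j) (CoprodObj.obj d j)).hom :=
  Category.id_comp (unitTensorIso (CoprodObj.obj c j) (CoprodObj.obj d j)).hom

lemma comp_coprodProj_ε (G : StrongFunctor A (coprod C)) (j : J) :
    ε (compFunctor G (coprodProj C j)).functor = CoprodObj.Hom.app (ε G.functor) j :=
  (congrArg (· ≫ CoprodObj.Hom.app (ε G.functor) j) (coprodProj_ε j)).trans (Category.id_comp _)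

lemma comp_coprodProj_μ (G : StrongFunctor A (coprod C)) (j : J) (X Y : A) :
    μ (compFunctor G (coprodProj C j)).functor X Y =
      (unitTensorIso _ _).hom ≫ CoprodObj.Hom.app (μ G.functor X Y) j :=
  congrArg (· ≫ CoprodObj.Hom.app (μ G.functor X Y) j) (coprodProj_μ j _ _)

lemma toCoprod_comp_coprodProj (F : ∀ j, StrongFunctor A (C j)) (hF) (j : J) :
    compFunctor (toCoprod F hF) (coprodProj C j) = F j :=
  strongFunctor_ext (F := (F j).functor)
    (compFunctor (toCoprod F hF) (coprodProj C j)).braided (F j).braided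
    (comp_coprodProj_ε _ j)
    (fun X Y => (comp_coprodProj_μ _ j X Y).trans (Iso.hom_inv_id_assoc _ _))

lemma incl_comp_coprodProj_self (j : J) : incl C j ≫ coprodProj C j = 𝟙 (C j) :=
  (toCoprod_comp_coprodProj _ _ j).trans (delta_self C j)

lemma incl_comp_coprodProj_of_ne {j k : J} (h : j ≠ k) :
    incl C j ≫ coprodProj C k = 𝟙_ (C j ⟶ C k) :=
  (toCoprod_comp_coprodProj _ _ k).trans (delta_of_ne C h)

variable [DecidableEq J]

/-- The filtration of the coproduct by the supports of morphisms. -/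
def suppFiltration (C : J → SymMonCat.{v, u}) : Filtration (Finset J) (coprod C) where
  supp s _ _ f := ∀ j ∉ s, IsUnitId (CoprodObj.Hom.app f j)
  monotone _ _ h _ _ _ hf j hj := hf j fun hs => hj (h hs)
  id_source hf j hj := isUnitId_id (hf j hj).1
  id_target hf j hj := isUnitId_id (hf j hj).2.1
  inf {s t _ _ f} hs ht j hj := by
    rcases not_and_or.1 (Finset.mem_inter.not.1 hj) with h | h
    exacts [hs j h, ht j h]
  exhaustive f := by
    have h := CoprodObj.Hom.finite f
    exact ⟨h.toFinset, fun j hj => not_not.1 fun hf => hj ((Set.Finite.mem_toFinset h).2 hf)⟩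

lemma landsIn_toCoprod {F : ∀ j, StrongFunctor A (C j)} (hF) {s : Finset J}
    (h : ∀ j ∉ s, F j = unitFunctor A (C j)) :
    (suppFiltration C).LandsIn s (toCoprod F hF) where
  map f j hj := isUnitId_map (h j hj) f
  unit j hj := isUnitId_ε (h j hj)
  tensor a b j hj := isUnitId_μ (h j hj) a b

lemma landsIn_incl (j : J) : (suppFiltration C).LandsIn {j} (incl C j) :=
  landsIn_toCoprod _ fun _ hk => delta_of_ne C fun h => hk (Finset.mem_singleton.2 h.symm)

/-- The projection from the coproduct to a finite partial product. -/
noncomputable def stageRes (C : J → SymMonCat.{max w v, max w u}) (s : Finset J) :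
    coprod C ⟶ prod fun j : s => C j :=
  pair fun j : s => coprodProj C j

/-- The components of the inclusion of a finite partial product in the coproduct. -/
def stageExtComponent (C : J → SymMonCat.{max w v, max w u}) (s : Finset J) (j : J) :
    StrongFunctor (prod fun j : s => C j) (C j) :=
  if h : j ∈ s then proj (fun j : s => C j) ⟨j, h⟩ else unitFunctor _ _

lemma stageExtComponent_of_notMem {s : Finset J} {j : J} (h : j ∉ s) :
    stageExtComponent C s j = unitFunctor _ _ := dif_neg h

/-- The inclusion of a finite partial product in the coproduct. -/
noncomputable def stageExt (C : J → SymMonCat.{max w v, max w u}) (s : Finset J) :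
    prod (fun j : s => C j) ⟶ coprod C :=
  toCoprod (stageExtComponent C s) (s.finite_toSet.subset fun _ hj =>
    by_contra fun h => hj (stageExtComponent_of_notMem h))

lemma stageExt_comp_coprodProj (s : Finset J) (j : s) :
    stageExt C s ≫ coprodProj C j = proj (fun j : s => C j) j :=
  (toCoprod_comp_coprodProj _ _ _).trans (dif_pos j.2)

end Coprod

section CoprodStages

open Functor.LaxMonoidal

lemma CoprodObj.obj_injective {J : Type w} {C : J → SymMonCat.{v, u}} {c d : CoprodObj C}
    (h : ∀ j, c.obj j = d.obj j) : c = d := by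
  cases c
  cases d
  simpa only [CoprodObj.mk.injEq] using funext h

variable {J : Type w} {C : J → SymMonCat.{max w v, max w u}} {s : Finset J}

lemma isTwoCoproduct_incl_comp_stageRes (C : J → SymMonCat.{max w v, max w u}) (s : Finset J) :
    IsTwoCoproduct fun j : s => incl C j ≫ stageRes C s := by
  have incl_comp_proj (j k : s) : (incl C j ≫ stageRes C s) ≫ proj _ k =
      incl C j ≫ coprodProj C k :=
    (Bicategory.Strict.assoc (incl C j.1) (stageRes C s) (proj _ k)).trans
      (congrArg (incl C j ≫ ·) (pair_comp_proj _ k))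
  refine isTwoCoproduct_of_biproduct
    (isEquivalence_coneComparison (isStrictTwoProduct_proj fun j : s => C j) _)
    (fun j => ⟨eqToIso ?_⟩) fun j k hjk => ⟨eqToIso ?_⟩
  · exact (incl_comp_proj j j).trans (incl_comp_coprodProj_self j.1)
  · exact (incl_comp_proj j k).trans (incl_comp_coprodProj_of_ne (Subtype.coe_ne_coe.2 hjk))

lemma comp_eq_of_iso_comp_eq {A : Type u} [Category.{v} A] {X Y Z X' Y' Z' : A} (e : X ≅ Y)
    {f : Y ⟶ Z} {g : Z ⟶ Z'} {h : X ⟶ X'} {k : X' ⟶ Y'} {l : Y' ⟶ Z'}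
    (w : (e.hom ≫ f) ≫ g = h ≫ k ≫ l) : f ≫ g = (e.inv ≫ h ≫ k) ≫ l := by
  rw [Category.assoc, Iso.eq_inv_comp, Category.assoc, ← w, Category.assoc]

section Components

variable {A : SymMonCat.{max w v, max w u}} {G H : StrongFunctor A (coprod C)} {j : J}
  (τ : compFunctor G (coprodProj C j) ⟶ compFunctor H (coprodProj C j))

lemma coprodProj_natTrans_unit :
    CoprodObj.Hom.app (ε G.functor) j ≫ τ.natTrans.app (𝟙_ A) =
      CoprodObj.Hom.app (ε H.functor) j :=
  (congrArg (· ≫ _) (comp_coprodProj_ε G j)).symm.trans <|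
    (NatTrans.IsMonoidal.unit (τ := τ.natTrans)).trans (comp_coprodProj_ε H j)

lemma coprodProj_natTrans_tensor (a b : A) :
    CoprodObj.Hom.app (μ G.functor a b) j ≫ τ.natTrans.app (a ⊗ b) =
      ((unitTensorIso _ _).inv ≫ (τ.natTrans.app a ⊗ₘ τ.natTrans.app b) ≫
        (unitTensorIso _ _).hom) ≫ CoprodObj.Hom.app (μ H.functor a b) j :=
  comp_eq_of_iso_comp_eq (unitTensorIso _ _) <|
    (congrArg (· ≫ _) (comp_coprodProj_μ G j a b)).symm.trans <|
      (NatTrans.IsMonoidal.tensor (τ := τ.natTrans) a b).trans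
        (congrArg (_ ≫ ·) (comp_coprodProj_μ H j a b))

end Components

variable [DecidableEq J]

lemma suppFiltration_hom_ext {c d : coprod C} {f g : c ⟶ d} (hf : (suppFiltration C).supp s f)
    (hg : (suppFiltration C).supp s g)
    (h : ∀ j ∈ s, CoprodObj.Hom.app f j = CoprodObj.Hom.app g j) : f = g :=
  CoprodObj.hom_ext fun j =>
    if hj : j ∈ s then h j hj else (hf j hj).ext (hg j hj)

lemma suppFiltration_comp {c d e : coprod C} {f : c ⟶ d} {g : d ⟶ e}
    (hf : (suppFiltration C).supp s f) (hg : (suppFiltration C).supp s g) :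
    (suppFiltration C).supp s (f ≫ g) :=
  fun j hj => (hf j hj).comp (hg j hj)

lemma suppFiltration_tensorHom {c d c' d' : coprod C} {f : c ⟶ d} {g : c' ⟶ d'}
    (hf : (suppFiltration C).supp s f) (hg : (suppFiltration C).supp s g) :
    (suppFiltration C).supp s (f ⊗ₘ g) :=
  fun j hj => isUnitId_tensor (hf j hj) (hg j hj)

lemma suppFiltration_eqToHom {c d : coprod C} (h : c = d) (hd : (suppFiltration C).supp s (𝟙 d)) :
    (suppFiltration C).supp s (eqToHom h) := by
  subst h
  exact hd

lemma landsIn_stageExt (s : Finset J) : (suppFiltration C).LandsIn s (stageExt C s) :=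
  landsIn_toCoprod _ fun _ => stageExtComponent_of_notMem

lemma landsIn_comp_stageExt (s : Finset J) :
    (suppFiltration C).LandsIn s (compFunctor (stageRes C s) (stageExt C s)) where
  map _ := (landsIn_stageExt s).map _
  unit := suppFiltration_comp (landsIn_stageExt s).unit ((landsIn_stageExt s).map _)
  tensor _ _ := suppFiltration_comp ((landsIn_stageExt s).tensor _ _) ((landsIn_stageExt s).map _)

lemma stageExt_comp_stageRes (s : Finset J) :
    compFunctor (stageExt C s) (stageRes C s) = idFunctor (prod fun j : s => C j) := by
  have components (j : s) : compFunctor (compFunctor (stageExt C s) (stageRes C s)) (proj _ j) =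
      compFunctor (idFunctor _) (proj _ j) :=
    (Bicategory.Strict.assoc (stageExt C s) (stageRes C s) (proj _ j)).trans <| calc
    stageExt C s ≫ (stageRes C s ≫ proj _ j) = stageExt C s ≫ coprodProj C j :=
      congrArg (stageExt C s ≫ ·) (pair_comp_proj _ j)
    _ = 𝟙 _ ≫ proj _ j := (stageExt_comp_coprodProj s j).trans (Category.id_comp _).symm
  rw [← pair_proj_comp (compFunctor _ _), funext components, pair_proj_comp]

lemma stageRes_comp_stageExt_comp_coprodProj (j : s) :
    compFunctor (compFunctor (stageRes C s) (stageExt C s)) (coprodProj C j) =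
      compFunctor (idFunctor (coprod C)) (coprodProj C j) :=
  (Bicategory.Strict.assoc (stageRes C s) (stageExt C s) (coprodProj C j)).trans <| calc
    stageRes C s ≫ (stageExt C s ≫ coprodProj C j)
    _ = stageRes C s ≫ proj _ j := congrArg (stageRes C s ≫ ·) (stageExt_comp_coprodProj s j)
    _ = coprodProj C j := pair_comp_proj _ j
    _ = 𝟙 _ ≫ coprodProj C j := (Category.id_comp _).symm

lemma stageExt_obj_stageRes_obj {c : coprod C} (hc : (suppFiltration C).supp s (𝟙 c)) :
    (stageExt C s).functor.obj ((stageRes C s).functor.obj c) = c :=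
  CoprodObj.obj_injective fun j =>
    if hj : j ∈ s then
      congrArg (fun F => F.functor.obj c) (stageRes_comp_stageExt_comp_coprodProj ⟨j, hj⟩)
    else ((landsIn_stageExt s).id_obj _ j hj).1.trans (hc j hj).1.symm

lemma eqToHom_stageExt_obj_stageRes_obj_app {c : coprod C} (hc : (suppFiltration C).supp s (𝟙 c))
    {j : J} (hj : j ∈ s) :
    CoprodObj.Hom.app (eqToHom (stageExt_obj_stageRes_obj hc)) j =
      (eqToHom (stageRes_comp_stageExt_comp_coprodProj (C := C) ⟨j, hj⟩)).natTrans.app c :=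
  (CoprodObj.eqToHom_app _ j).trans
    (eqToHom_natTrans_app (stageRes_comp_stageExt_comp_coprodProj (C := C) ⟨j, hj⟩) c).symm

/-- The counit of the equivalence between a stage of the coproduct and a finite product. -/
noncomputable def stageCounit (C : J → SymMonCat.{max w v, max w u}) (s : Finset J) :
    PartialTrans (suppFiltration C) s (compFunctor (stageRes C s) (stageExt C s))
      (idFunctor (coprod C)) where
  app c hc := eqToHom (stageExt_obj_stageRes_obj hc)
  naturality {c d} f hf := by
    have hc := (suppFiltration C).id_source hf
    have hd := (suppFiltration C).id_target hf
    refine suppFiltration_hom_ext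
      (suppFiltration_comp ((landsIn_stageExt s).map _)
        (suppFiltration_eqToHom (stageExt_obj_stageRes_obj hd) hd))
      (suppFiltration_comp (suppFiltration_eqToHom (stageExt_obj_stageRes_obj hc) hc) hf)
      fun j hj => ?_
    refine (congrArg (_ ≫ ·) (eqToHom_stageExt_obj_stageRes_obj_app hd hj)).trans (.trans ?_
      (congrArg (· ≫ _) (eqToHom_stageExt_obj_stageRes_obj_app hc hj)).symm)
    exact (eqToHom
      (stageRes_comp_stageExt_comp_coprodProj (C := C) ⟨j, hj⟩)).natTrans.naturality f
  unit h := by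
    refine suppFiltration_hom_ext
      (suppFiltration_comp (landsIn_comp_stageExt s).unit
        (suppFiltration_eqToHom (stageExt_obj_stageRes_obj h) h)) h fun j hj => ?_
    exact (congrArg (_ ≫ ·) (eqToHom_stageExt_obj_stageRes_obj_app h hj)).trans
      (coprodProj_natTrans_unit _)
  tensor c d hc hd hcd := by
    refine suppFiltration_hom_ext
      (suppFiltration_comp ((landsIn_comp_stageExt s).tensor c d)
        (suppFiltration_eqToHom (stageExt_obj_stageRes_obj hcd) hcd))
      (suppFiltration_comp (suppFiltration_tensorHom
        (suppFiltration_eqToHom (stageExt_obj_stageRes_obj hc) hc)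
        (suppFiltration_eqToHom (stageExt_obj_stageRes_obj hd) hd)) hcd) fun j hj => ?_
    refine (congrArg (_ ≫ ·) (eqToHom_stageExt_obj_stageRes_obj_app hcd hj)).trans
      ((coprodProj_natTrans_tensor _ c d).trans ?_)
    exact congrArg (fun f => ((unitTensorIso _ _).inv ≫ f ≫ (unitTensorIso _ _).hom) ≫ _)
      (congrArg₂ (· ⊗ₘ ·) (eqToHom_stageExt_obj_stageRes_obj_app hc hj)
        (eqToHom_stageExt_obj_stageRes_obj_app hd hj)).symm

/-- A stage of the coproduct is a finite product. -/
noncomputable def stageEquivalence (C : J → SymMonCat.{max w v, max w u}) (s : Finset J) :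
    StageEquivalence (suppFiltration C) s (prod fun j : s => C j) where
  res := stageRes C s
  ext := stageExt C s
  landsIn_ext := landsIn_stageExt s
  counit := stageCounit C s
  supp_counit _ hc := suppFiltration_eqToHom (stageExt_obj_stageRes_obj hc) hc
  isIso_counit _ hc :=
    have h := stageExt_obj_stageRes_obj hc
    (eqToIso h).isIso_hom
  ext_comp_res := stageExt_comp_stageRes s

end CoprodStages

theorem isTwoCoproduct_incl {J : Type w} (C : J → SymMonCat.{max w v, max w u}) :
    IsTwoCoproduct (incl C) := fun _ => by
  classical
  exact isEquivalence_coconeComparison landsIn_incl fun s =>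
    (stageEquivalence C s).isEquivalence_stageComparison landsIn_incl
      (isTwoCoproduct_incl_comp_stageRes C s)

end SymMonCat

theorem mainTheorem8 (J : Type w) (C : J → SymMonCat.{max w v, max w u}) :
    IsStrictTwoProduct (SymMonCat.proj C) ∧ IsTwoCoproduct (SymMonCat.incl C) :=
  ⟨SymMonCat.isStrictTwoProduct_proj C, SymMonCat.isTwoCoproduct_incl C⟩
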